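/- **Setting.** Let $\mathbb T=\{|\zeta|=1\}$ and let $w$ be a regular semi-classical weight on $\mathbb T$: there are polynomials $V,W$ with $\deg W\ge 2$, $\deg V<\deg W$, $W$ having distinct zeros $z_1,\dots,z_m$, residues $\rho_k=2V(z_k)/W'(z_k)\notin\mathbb Z_{\ge 0}$ for all $k$, and $$W(\zeta)w'(\zeta)=2V(\zeta)w(\zeta)\qquad(\zeta\in\mathbb T,\ W(\zeta)\neq 0),$$ where $w'$ is the derivative of $w$ along $\mathbb T$. (Zeros of $W$ may lie on $\mathbb T$, and $w$ may take different branches on the arcs between them.) Assume $W(0)=0$ and $w,w'\in L^1(\mathbb T)$. Let $\phi_n,\bar\phi_n$ ($n\ge 0$) be polynomials of exact degree $n$ with the same leading coefficient $\kappa_n$ such that $$\int_{\mathbb T}\frac{d\zeta}{2\pi i\zeta}\,w(\zeta)\phi_m(\zeta)\bar\phi_n(\bar\zeta)=\delta_{m,n}\qquad(m,n\ge0);$$ the coefficients of $\bar\phi_n$ need not be the complex conjugates of those of $\phi_n$. Put $\phi_n^*(z)=z^n\bar\phi_n(1/z)$ and $$F(z)=\int_{\mathbb T}\frac{d\zeta}{2\pi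 i\zeta}\frac{\zeta+z}{\zeta-z}w(\zeta),\qquad \epsilon_n=\psi_n+F\phi_n,\qquad \epsilon_n^*=\psi_n^*-F\phi_n^*,$$ where $\psi_0=\psi_0^*=1/\kappa_0$ and, for $n\ge1$, $$\psi_n(z)=\int_{\mathbb T}\frac{d\zeta}{2\pi i\zeta}\frac{\zeta+z}{\zeta-z}w(\zeta)[\phi_n(\zeta)-\phi_n(z)],\qquad \psi^*_n(z)=-\int_{\mathbb T}\frac{d\zeta}{2\pi i\zeta}\frac{\zeta+z}{\zeta-z}w(\zeta)[z^n\bar\phi_n(\bar\zeta)-\phi^*_n(z)].$$ **Statement.** Fix $n\ge 0$. The integral $F(z_j)$ converges absolutely for every zero $z_j$ of $W$ (also when $|z_j|=1$), and the following hold. (A) Suppose $\phi_{n+1}(0)\neq0$. There is a unique pair of polynomials $\Theta_n,\Omega_n$ such that, for all $z\notin\mathbb T$, $$W\phi_n'=\Theta_n\phi_{n+1}-(\Omega_n+V)\phi_n,\qquad W\epsilon_n'=\Theta_n\epsilon_{n+1}-(\Omega_n-V)\epsilon_n,$$ and for every zero $z_j$ of $W$ $$\phi_n(z_j)\epsilon_n(z_j)=2\frac{\phi_{n+1}(0)}{\kappa_n}z_j^n\frac{\Theta_n(z_j)}{2V(z_j)},$$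 $$\phi_{n+1}(z_j)\epsilon_n(z_j)=2\frac{\phi_{n+1}(0)}{\kappa_n}z_j^n\frac{\Omega_n(z_j)+V(z_j)}{2V(z_j)},\qquad \phi_n(z_j)\epsilon_{n+1}(z_j)=2\frac{\phi_{n+1}(0)}{\kappa_n}z_j^n\frac{\Omega_n(z_j)-V(z_j)}{2V(z_j)},$$ $$\phi_n(z_j)\epsilon^*_n(z_j)=-\frac{z_j^n}{V(z_j)}\Big[\Omega_n(z_j)-V(z_j)-\frac{\kappa_{n+1}}{\kappa_n}z_j\Theta_n(z_j)\Big],$$ $$\phi^*_n(z_j)\epsilon_n(z_j)=\frac{z_j^n}{V(z_j)}\Big[\Omega_n(z_j)+V(z_j)-\frac{\kappa_{n+1}}{\kappa_n}z_j\Theta_n(z_j)\Big].$$ (B) Suppose $\bar\phi_{n+1}(0)\neq0$. There is a unique pair of polynomials $\Theta^*_n,\Omega^*_n$ such that, for all $z\notin\mathbb T$, $$W{\phi_n^*}'=-\Theta^*_n\phi^*_{n+1}+(\Omega^*_n-V)\phi^*_n,\qquad W{\epsilon_n^*}'=-\Theta^*_n\epsilon^*_{n+1}+(\Omega^*_n+V)\epsilon^*_n,$$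 and for every zero $z_j$ of $W$ $$\phi^*_n(z_j)\epsilon^*_n(z_j)=-2\frac{\bar\phi_{n+1}(0)}{\kappa_n}z_j^{n+1}\frac{\Theta^*_n(z_j)}{2V(z_j)},$$ $$\phi^*_n(z_j)\epsilon^*_{n+1}(z_j)=-2\frac{\bar\phi_{n+1}(0)}{\kappa_n}z_j^{n+1}\frac{\Omega^*_n(z_j)+V(z_j)}{2V(z_j)},\qquad \phi^*_{n+1}(z_j)\epsilon^*_n(z_j)=-2\frac{\bar\phi_{n+1}(0)}{\kappa_n}z_j^{n+1}\frac{\Omega^*_n(z_j)-V(z_j)}{2V(z_j)},$$ $$\phi_n(z_j)\epsilon^*_n(z_j)=-\frac{z_j^n}{V(z_j)}\Big[\Omega^*_n(z_j)-V(z_j)-\frac{\kappa_{n+1}}{\kappa_n}\Theta^*_n(z_j)\Big],$$ $$\phi^*_n(z_j)\epsilon_n(z_j)=\frac{z_j^n}{V(z_j)}\Big[\Omega^*_n(z_j)+V(z_j)-\frac{\kappa_{n+1}}{\kappa_n}\Theta^*_n(z_j)\Big].$$ -/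

import Mathlib

open Polynomial

noncomputable section

namespace BiorthUnitCircle

/-- The unit circle `|ζ| = 1` in the complex plane. -/
def unitCircle : Set ℂ := Metric.sphere 0 1

/-- The normalised contour integral `∫_𝕋 dζ / (2πiζ) f(ζ)` over the positively oriented unit
circle. -/
def circMean (f : ℂ → ℂ) : ℂ :=
  (2 * (Real.pi : ℂ) * Complex.I)⁻¹ * ∮ ζ in C(0, 1), f ζ / ζ

/-- The derivative `w'(ζ) = dw/dζ` of a weight along the unit circle. It is the restriction of the
complex derivative whenever `w` is holomorphic near the point `ζ` of the circle. -/
def weightDeriv (w : ℂ → ℂ) (ζ : ℂ) : ℂ := derivWithin w unitCircle ζ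

/-- `w` is a regular semi-classical weight on the unit circle with data `V`, `W`:
`W w' = 2 V w` on the circle away from the zeros of `W`, where `deg W ≥ 2`, `deg V < deg W`, the
zeros of `W` are distinct, and no residue `2 V(z_k) / W'(z_k)` is a non-negative integer.
The weight may take unrelated branches on the different arcs into which the zeros of `W` lying on
the circle divide it; it is single valued across every other point of the circle. -/
structure IsRegularSemiclassical (w : ℂ → ℂ) (V W : ℂ[X]) : Prop where
  two_le_degree : 2 ≤ W.natDegree
  degree_lt : V.degree < W.degree
  zeros_distinct : W.roots.Nodup
  residue_ne : ∀ z : ℂ, W.eval z = 0 → ∀ k : ℕ, 2 * V.eval z / (derivative W).eval z ≠ (k : ℂ)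
  differentiable : ∀ ζ ∈ unitCircle, W.eval ζ ≠ 0 → DifferentiableWithinAt ℂ w unitCircle ζ
  pearson : ∀ ζ ∈ unitCircle, W.eval ζ ≠ 0 →
    W.eval ζ * weightDeriv w ζ = 2 * V.eval ζ * w ζ

/-- An orthonormal system `φ_n`, `φ̄_n` of bi-orthogonal polynomials on the unit circle with respect
to `w`, normalised so that `φ_n` and `φ̄_n` have the same leading coefficient. The coefficients of
`phiBar n` are unrelated to the complex conjugates of those of `phi n`. -/
structure BiorthSystem (w : ℂ → ℂ) where
  phi : ℕ → ℂ[X]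
  phiBar : ℕ → ℂ[X]
  degree_phi : ∀ n, (phi n).degree = (n : WithBot ℕ)
  degree_phiBar : ∀ n, (phiBar n).degree = (n : WithBot ℕ)
  leading_eq : ∀ n, (phiBar n).coeff n = (phi n).coeff n
  orthonormal : ∀ m n,
    circMean (fun ζ => w ζ * (phi m).eval ζ * (phiBar n).eval ((starRingEnd ℂ) ζ))
      = if m = n then 1 else 0

/-- The Carathéodory function `F(z) = ∫_𝕋 dζ/(2πiζ) (ζ+z)/(ζ-z) w(ζ)`. -/
def carath (w : ℂ → ℂ) (z : ℂ) : ℂ := circMean (fun ζ => (ζ + z) / (ζ - z) * w ζ)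

namespace BiorthSystem

variable {w : ℂ → ℂ} (S : BiorthSystem w)

/-- The common leading coefficient `κ_n` of `φ_n` and `φ̄_n`. -/
def kappa (n : ℕ) : ℂ := (S.phi n).coeff n

/-- The reciprocal polynomial `φ*_n(z) = z^n φ̄_n(1/z) = ∑_j c̄_{n,j} z^{n-j}`. -/
def phiStar (n : ℕ) : ℂ[X] := (S.phiBar n).reflect n

/-- The associated polynomial `ψ_n`, with `ψ_0 = 1/κ_0`. -/
def psi (n : ℕ) (z : ℂ) : ℂ :=
  if n = 0 then 1 / S.kappa 0
  else circMean (fun ζ => (ζ + z) / (ζ - z) * w ζ * ((S.phi n).eval ζ - (S.phi n).eval z))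

/-- The reciprocal associated polynomial `ψ*_n`, with `ψ*_0 = 1/κ_0`. -/
def psiStar (n : ℕ) (z : ℂ) : ℂ :=
  if n = 0 then 1 / S.kappa 0
  else -circMean (fun ζ => (ζ + z) / (ζ - z) * w ζ *
    (z ^ n * (S.phiBar n).eval ((starRingEnd ℂ) ζ) - (S.phiStar n).eval z))

/-- The associated function `ε_n = ψ_n + F φ_n`. -/
def eps (n : ℕ) (z : ℂ) : ℂ := S.psi n z + carath w z * (S.phi n).eval z

/-- The reciprocal associated function `ε*_n = ψ*_n - F φ*_n`. -/
def epsStar (n : ℕ) (z : ℂ) : ℂ := S.psiStar n z - carath w z * (S.phiStar n).eval z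

/-- `Θ = p.1` and `Ω = p.2` are coefficient functions of the spectral derivatives of `φ_n`, `ε_n`:
`W φ_n' = Θ φ_{n+1} - (Ω + V) φ_n` and `W ε_n' = Θ ε_{n+1} - (Ω - V) ε_n` off the unit circle. -/
def IsCoeffPair (V W : ℂ[X]) (n : ℕ) (p : ℂ[X] × ℂ[X]) : Prop :=
  ∀ z : ℂ, z ∉ unitCircle →
    W.eval z * (derivative (S.phi n)).eval z
        = p.1.eval z * (S.phi (n + 1)).eval z
          - (p.2.eval z + V.eval z) * (S.phi n).eval z ∧
    W.eval z * deriv (S.eps n) z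
        = p.1.eval z * S.eps (n + 1) z - (p.2.eval z - V.eval z) * S.eps n z

/-- `Θ* = p.1` and `Ω* = p.2` are coefficient functions of the spectral derivatives of `φ*_n`,
`ε*_n`: `W φ*_n' = -Θ* φ*_{n+1} + (Ω* - V) φ*_n` and `W ε*_n' = -Θ* ε*_{n+1} + (Ω* + V) ε*_n` off
the unit circle. -/
def IsCoeffPairStar (V W : ℂ[X]) (n : ℕ) (p : ℂ[X] × ℂ[X]) : Prop :=
  ∀ z : ℂ, z ∉ unitCircle →
    W.eval z * (derivative (S.phiStar n)).eval z
        = -(p.1.eval z * (S.phiStar (n + 1)).eval z)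
          + (p.2.eval z - V.eval z) * (S.phiStar n).eval z ∧
    W.eval z * deriv (S.epsStar n) z
        = -(p.1.eval z * S.epsStar (n + 1) z) + (p.2.eval z + V.eval z) * S.epsStar n z

/-- The coefficient functions `(Θ_n, Ω_n)`. -/
def coeffPair (V W : ℂ[X]) (n : ℕ) : ℂ[X] × ℂ[X] :=
  Classical.epsilon (S.IsCoeffPair V W n)

/-- The coefficient functions `(Θ*_n, Ω*_n)`. -/
def coeffPairStar (V W : ℂ[X]) (n : ℕ) : ℂ[X] × ℂ[X] :=
  Classical.epsilon (S.IsCoeffPairStar V W n)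

/-- The coefficient function `Θ_n`. -/
def Theta (V W : ℂ[X]) (n : ℕ) : ℂ[X] := (S.coeffPair V W n).1

/-- The coefficient function `Ω_n`. -/
def Omega (V W : ℂ[X]) (n : ℕ) : ℂ[X] := (S.coeffPair V W n).2

/-- The coefficient function `Θ*_n`. -/
def ThetaStar (V W : ℂ[X]) (n : ℕ) : ℂ[X] := (S.coeffPairStar V W n).1

/-- The coefficient function `Ω*_n`. -/
def OmegaStar (V W : ℂ[X]) (n : ℕ) : ℂ[X] := (S.coeffPairStar V W n).2

end BiorthSystem

end BiorthUnitCircle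

end

open Polynomial

noncomputable section

/-! ### Circle integrals and Cauchy transforms. -/

namespace BiorthUnitCircle

open MeasureTheory Filter Topology Set

/-! Write C[f] for the Cauchy transform of f on the circle. The residue at z_j is not 0, so V(z_j) ≠
0, and the equation W w' = 2 V w expresses w/(ζ - z_j) through w and w'. Hence the Cauchy kernel is
integrable against w at every zero of W, also on the circle. Integrability of w' gives w one-sided
limits there, and these are 0 because 1/t is not integrable. So integration by parts on the circle
has no boundary terms (`circleIntegral_parts`), and W C[wp]' equals C[w(2Vp + Wp')] up to a
polynomial in z (`exists_eval_mul_deriv_polyTransform`). This relation persists at the zeros of W on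
the circle, where its left side is 0, so no limit onto the circle is ever taken.

Bi-orthogonality gives ε_n = 2C[wφ_n] and ε*_n = 2/κ_n - 2C[wφ*_n]. The Szegő recurrences pass to
these functions with some signs changed, and induction yields φ_n ε*_n + φ*_n ε_n = 2z^n
(`casoratian`).

The core is `existsUnique_spectral`. Given pairs (p, e), (p₁, e₁) with K = p₁e - pe₁ = c z^N,
Cramer's rule turns the two spectral relations into KΘ = A and KΩ = B, where A = W(p'e - pe') + 2Vpe
and B = W(p'e₁ - p₁e') + V(pe₁ + p₁e). The Cauchy transforms cancel in A and B, so both are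
polynomials. They are divisible by z^N because e and e₁ vanish to order N at 0 and W(0) = 0 restores
the order lost by differentiating e. At a zero of W they reduce to 2Vpe and V(pe₁ + p₁e); together
with K this gives the bilinear formulas. The mixed products φ_n ε*_n and φ*_n ε_n then follow from
the recurrences and the Casoratian. -/

lemma mem_unitCircle {ζ : ℂ} : ζ ∈ unitCircle ↔ ‖ζ‖ = 1 := by
  simp [unitCircle]

lemma ne_zero_of_mem_unitCircle {ζ : ℂ} (h : ζ ∈ unitCircle) : ζ ≠ 0 := by
  rintro rfl
  simp [mem_unitCircle] at h

lemma conj_eq_inv_of_mem_unitCircle {ζ : ℂ} (h : ζ ∈ unitCircle) :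
    (starRingEnd ℂ) ζ = ζ⁻¹ := by
  rw [Complex.inv_def, Complex.normSq_eq_norm_sq, mem_unitCircle.1 h]
  simp

lemma circleMap_mem_unitCircle (θ : ℝ) : circleMap 0 1 θ ∈ unitCircle := by
  simp [mem_unitCircle]

lemma isClosed_unitCircle : IsClosed unitCircle := Metric.isClosed_sphere

lemma isOpen_compl_unitCircle : IsOpen unitCircleᶜ := isClosed_unitCircle.isOpen_compl

lemma zero_notMem_unitCircle : (0 : ℂ) ∉ unitCircle := by simp [mem_unitCircle]

/-- Integrands will be rewritten only away from finitely many points: the zeros of W, where nothing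
is known about w, and the pole of the kernel. Finite sets do not affect circle integrals. -/
lemma eventuallyEq_codiscreteWithin_of_finite {f g : ℂ → ℂ} {S : Set ℂ} (hS : S.Finite)
    (h : ∀ ζ ∈ unitCircle, ζ ∉ S → f ζ = g ζ) :
    f =ᶠ[codiscreteWithin (Metric.sphere 0 |1|)] g := by
  rw [Filter.EventuallyEq, Filter.Eventually, mem_codiscreteWithin_iff_forall_mem_nhdsNE]
  intro x _
  have h1 : (S \ {x})ᶜ ∈ 𝓝 x :=
    (hS.subset sdiff_subset).isClosed.isOpen_compl.mem_nhds (by simp)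
  filter_upwards [mem_nhdsWithin_of_mem_nhds h1, self_mem_nhdsWithin] with ζ h2 h3
  by_cases hζ : ζ ∈ unitCircle
  · left
    refine h ζ hζ fun hS => h2 ⟨hS, h3⟩
  · right
    simpa [unitCircle] using hζ

lemma circleIntegrable_congr_off_finite {f g : ℂ → ℂ} {S : Set ℂ} (hS : S.Finite)
    (h : ∀ ζ ∈ unitCircle, ζ ∉ S → f ζ = g ζ) (hf : CircleIntegrable f 0 1) :
    CircleIntegrable g 0 1 :=
  hf.congr_codiscreteWithin (eventuallyEq_codiscreteWithin_of_finite hS h)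

lemma circleIntegral_congr_off_finite {f g : ℂ → ℂ} {S : Set ℂ} (hS : S.Finite)
    (h : ∀ ζ ∈ unitCircle, ζ ∉ S → f ζ = g ζ) :
    (∮ ζ in C(0, 1), f ζ) = ∮ ζ in C(0, 1), g ζ :=
  circleIntegral.circleIntegral_congr_codiscreteWithin
    (eventuallyEq_codiscreteWithin_of_finite hS h) one_ne_zero

lemma circleIntegrable_mul_continuousOn {f g : ℂ → ℂ} (hf : CircleIntegrable f 0 1)
    (hg : ContinuousOn g unitCircle) : CircleIntegrable (fun ζ => f ζ * g ζ) 0 1 :=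
  hf.mul_continuousOn (by simpa [unitCircle] using hg)

/-- The Cauchy transform of a function on the unit circle. -/
def cauchyTransform (f : ℂ → ℂ) (z : ℂ) : ℂ :=
  (2 * (Real.pi : ℂ) * Complex.I)⁻¹ * ∮ ζ in C(0, 1), f ζ / (ζ - z)

lemma continuousOn_inv_sub {z : ℂ} (hz : z ∉ unitCircle) :
    ContinuousOn (fun ζ : ℂ => (ζ - z)⁻¹) unitCircle := by
  refine ContinuousOn.inv₀ (by fun_prop) fun ζ hζ h => hz ?_
  rwa [← sub_eq_zero.1 h]

lemma circleIntegrable_div_sub {f : ℂ → ℂ} (hf : CircleIntegrable f 0 1) {z : ℂ}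
    (hz : z ∉ unitCircle) : CircleIntegrable (fun ζ => f ζ / (ζ - z)) 0 1 := by
  simp_rw [div_eq_mul_inv]
  exact circleIntegrable_mul_continuousOn hf (continuousOn_inv_sub hz)

/-- Differentiation under the integral sign: on a ball of radius δ whose double avoids the circle,
the differentiated kernel is at most δ⁻² in norm, so ‖f‖ δ⁻² is an integrable bound. -/
lemma hasDerivAt_cauchyTransform {f : ℂ → ℂ} (hf : CircleIntegrable f 0 1) {z : ℂ}
    (hz : z ∉ unitCircle) :
    HasDerivAt (cauchyTransform f)
      ((2 * (Real.pi : ℂ) * Complex.I)⁻¹ * ∮ ζ in C(0, 1), f ζ / (ζ - z) ^ 2) z := by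
  obtain ⟨δ, hδ, hball⟩ : ∃ δ > 0, Metric.ball z (2 * δ) ⊆ unitCircleᶜ := by
    obtain ⟨ε, hε, h⟩ := Metric.isOpen_iff.1 isOpen_compl_unitCircle z hz
    exact ⟨ε / 2, by positivity, by simpa [mul_div_cancel₀] using h⟩
  have hsub : ∀ x ∈ Metric.ball z δ, x ∉ unitCircle := fun x hx =>
    hball (Metric.ball_subset_ball (by linarith) hx)
  have hge : ∀ x ∈ Metric.ball z δ, ∀ ζ ∈ unitCircle, δ ≤ ‖ζ - x‖ := by
    intro x hx ζ hζ
    by_contra! hlt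
    refine hball ?_ hζ
    rw [Metric.mem_ball, dist_eq_norm] at *
    calc ‖ζ - z‖ = ‖(ζ - x) + (x - z)‖ := by ring_nf
      _ ≤ ‖ζ - x‖ + ‖x - z‖ := norm_add_le _ _
      _ < 2 * δ := by linarith
  refine HasDerivAt.const_mul _ ?_
  have key := intervalIntegral.hasDerivAt_integral_of_dominated_loc_of_deriv_le
    (μ := volume) (a := 0) (b := 2 * Real.pi) (x₀ := z) (s := Metric.ball z δ)
    (F := fun x θ => deriv (circleMap 0 1) θ • (f (circleMap 0 1 θ) / (circleMap 0 1 θ - x)))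
    (F' := fun x θ => deriv (circleMap 0 1) θ • (f (circleMap 0 1 θ) / (circleMap 0 1 θ - x) ^ 2))
    (bound := fun θ => ‖f (circleMap 0 1 θ)‖ * (δ ^ 2)⁻¹)
    (Metric.ball_mem_nhds z hδ) ?_ ?_ ?_ ?_ ?_ ?_
  · exact key.2
  · filter_upwards [Metric.ball_mem_nhds z hδ] with x hx
    exact (circleIntegrable_div_sub hf (hsub x hx)).out.def'.aestronglyMeasurable
  · exact (circleIntegrable_div_sub hf hz).out
  · have : CircleIntegrable (fun ζ => f ζ / (ζ - z) ^ 2) 0 1 := by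
      simp_rw [div_eq_mul_inv]
      refine circleIntegrable_mul_continuousOn hf ?_
      simp_rw [← inv_pow]
      exact (continuousOn_inv_sub hz).pow 2
    exact this.out.def'.aestronglyMeasurable
  · refine Eventually.of_forall fun θ _ x hx => ?_
    have h1 := hge x hx _ (circleMap_mem_unitCircle θ)
    rw [norm_smul, norm_div, norm_pow, deriv_circleMap, norm_mul, Complex.norm_I,
      mem_unitCircle.1 (circleMap_mem_unitCircle θ), one_mul, one_mul, div_eq_mul_inv]
    gcongr
  · exact (IntervalIntegrable.norm hf).mul_const _
  · refine Eventually.of_forall fun θ _ x hx => ?_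
    have h0 : circleMap 0 1 θ - x ≠ 0 := by
      intro h
      have := hge x hx _ (circleMap_mem_unitCircle θ)
      rw [h, norm_zero] at this
      linarith
    have h1 : HasDerivAt (fun x => circleMap 0 1 θ - x) (-1) x := by
      simpa using (hasDerivAt_id x).const_sub (circleMap 0 1 θ)
    have h2 := ((h1.inv h0).const_mul (f (circleMap 0 1 θ))).const_mul (deriv (circleMap 0 1) θ)
    simp only [smul_eq_mul, div_eq_mul_inv]
    refine h2.congr_deriv ?_
    simp [div_eq_mul_inv]

lemma analyticAt_cauchyTransform {f : ℂ → ℂ} (hf : CircleIntegrable f 0 1) {z : ℂ}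
    (hz : z ∉ unitCircle) : AnalyticAt ℂ (cauchyTransform f) z := by
  have h : DifferentiableOn ℂ (cauchyTransform f) unitCircleᶜ := fun x hx =>
    (hasDerivAt_cauchyTransform hf hx).differentiableAt.differentiableWithinAt
  exact h.analyticAt (isOpen_compl_unitCircle.mem_nhds hz)

lemma cauchyTransform_congr {f g : ℂ → ℂ} (h : ∀ ζ ∈ unitCircle, f ζ = g ζ) (z : ℂ) :
    cauchyTransform f z = cauchyTransform g z := by
  unfold cauchyTransform
  rw [circleIntegral.integral_congr zero_le_one fun ζ hζ => by rw [h ζ hζ]]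

lemma circMean_congr {f g : ℂ → ℂ} (h : ∀ ζ ∈ unitCircle, f ζ = g ζ) :
    circMean f = circMean g := by
  unfold circMean
  rw [circleIntegral.integral_congr zero_le_one fun ζ hζ => by rw [h ζ hζ]]

lemma circleIntegrable_div_id {f : ℂ → ℂ} (hf : CircleIntegrable f 0 1) :
    CircleIntegrable (fun ζ => f ζ / ζ) 0 1 := by
  simpa using circleIntegrable_div_sub hf zero_notMem_unitCircle

lemma circMean_add {f g : ℂ → ℂ} (hf : CircleIntegrable f 0 1) (hg : CircleIntegrable g 0 1) :
    circMean (fun ζ => f ζ + g ζ) = circMean f + circMean g := by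
  unfold circMean
  simp_rw [add_div]
  rw [circleIntegral.integral_add (circleIntegrable_div_id hf) (circleIntegrable_div_id hg), mul_add]

lemma circMean_const_mul (c : ℂ) (f : ℂ → ℂ) :
    circMean (fun ζ => c * f ζ) = c * circMean f := by
  unfold circMean
  simp_rw [mul_div_assoc]
  rw [circleIntegral.integral_const_mul]
  ring

lemma cauchyTransform_add {f g : ℂ → ℂ} {z : ℂ}
    (hf : CircleIntegrable (fun ζ => f ζ / (ζ - z)) 0 1)
    (hg : CircleIntegrable (fun ζ => g ζ / (ζ - z)) 0 1) :
    cauchyTransform (fun ζ => f ζ + g ζ) z = cauchyTransform f z + cauchyTransform g z := by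
  unfold cauchyTransform
  simp_rw [add_div]
  rw [circleIntegral.integral_add hf hg, mul_add]

lemma cauchyTransform_const_mul (c : ℂ) (f : ℂ → ℂ) (z : ℂ) :
    cauchyTransform (fun ζ => c * f ζ) z = c * cauchyTransform f z := by
  unfold cauchyTransform
  simp_rw [mul_div_assoc]
  rw [circleIntegral.integral_const_mul]
  ring

/-- Multiplying the density by `ζ` multiplies the Cauchy transform by `z`, up to a moment. -/
lemma cauchyTransform_id_mul {f : ℂ → ℂ} {z : ℂ} (hf : CircleIntegrable f 0 1)
    (hfz : CircleIntegrable (fun ζ => f ζ / (ζ - z)) 0 1) :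
    cauchyTransform (fun ζ => ζ * f ζ) z = z * cauchyTransform f z + circMean (fun ζ => ζ * f ζ) := by
  unfold cauchyTransform circMean
  have h1 : (∮ ζ in C(0, 1), ζ * f ζ / (ζ - z)) =
      ∮ ζ in C(0, 1), (z * (f ζ / (ζ - z)) + f ζ) := by
    refine circleIntegral_congr_off_finite (finite_singleton z) fun ζ _ h => ?_
    have : ζ - z ≠ 0 := sub_ne_zero.2 h
    field_simp
    ring
  have h2 : (∮ ζ in C(0, 1), ζ * f ζ / ζ) = ∮ ζ in C(0, 1), f ζ := by
    refine circleIntegral_congr_off_finite (finite_singleton 0) fun ζ _ h => ?_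
    have : ζ ≠ 0 := h
    field_simp
  have h3 : CircleIntegrable (fun ζ => z * (f ζ / (ζ - z))) 0 1 := hfz.const_smul (a := z)
  rw [h1, h2, circleIntegral.integral_add h3 hf, circleIntegral.integral_const_mul]
  ring

/-- Keeping the moments explicit is the point: orthogonality will kill them and exhibit the order of
vanishing at 0. -/
lemma cauchyTransform_pow_mul {f : ℂ → ℂ} {z : ℂ} (hf : CircleIntegrable f 0 1)
    (hfz : CircleIntegrable (fun ζ => f ζ / (ζ - z)) 0 1) (m : ℕ) :
    cauchyTransform (fun ζ => ζ ^ m * f ζ) z = z ^ m * cauchyTransform f z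
      + ∑ i ∈ Finset.range m, z ^ (m - 1 - i) * circMean (fun ζ => ζ ^ (i + 1) * f ζ) := by
  induction m with
  | zero => simp
  | succ m ih =>
    have h1 : CircleIntegrable (fun ζ => ζ ^ m * f ζ) 0 1 := by
      simp_rw [mul_comm _ (f _)]
      exact circleIntegrable_mul_continuousOn hf (by fun_prop)
    have h2 : CircleIntegrable (fun ζ => ζ ^ m * f ζ / (ζ - z)) 0 1 := by
      simp_rw [mul_div_assoc, mul_comm _ (f _ / _)]
      exact circleIntegrable_mul_continuousOn hfz (by fun_prop)
    have h3 := cauchyTransform_id_mul h1 h2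
    simp_rw [← mul_assoc, ← pow_succ'] at h3
    rw [h3, ih, Finset.sum_range_succ, mul_add, Finset.mul_sum]
    have : ∀ i ∈ Finset.range m, z * (z ^ (m - 1 - i) * circMean (fun ζ => ζ ^ (i + 1) * f ζ))
        = z ^ (m + 1 - 1 - i) * circMean (fun ζ => ζ ^ (i + 1) * f ζ) := by
      intro i hi
      have : m + 1 - 1 - i = (m - 1 - i) + 1 := by
        have := Finset.mem_range.1 hi
        omega
      rw [this, pow_succ]
      ring
    rw [Finset.sum_congr rfl this]
    simp
    ring

/-- The contour integral of a divided difference of a polynomial is a polynomial. -/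
lemma exists_polynomial_integral_dividedDifference {f : ℂ → ℂ} (hf : CircleIntegrable f 0 1)
    (q : ℂ[X]) : ∃ P : ℂ[X], ∀ z : ℂ, ∃ d : ℂ[X],
      q - C (q.eval z) = (X - C z) * d ∧
      P.eval z = (2 * (Real.pi : ℂ) * Complex.I)⁻¹ * ∮ ζ in C(0, 1), f ζ * d.eval ζ := by
  have hint (d : ℂ[X]) : CircleIntegrable (fun ζ => f ζ * d.eval ζ) 0 1 :=
    circleIntegrable_mul_continuousOn hf d.continuous.continuousOn
  have hmonom (m : ℕ) (a : ℂ) : ∃ P : ℂ[X], ∀ z : ℂ, ∃ d : ℂ[X],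
      (C a * X ^ m : ℂ[X]) - C ((C a * X ^ m : ℂ[X]).eval z) = (X - C z) * d ∧
      P.eval z = (2 * (Real.pi : ℂ) * Complex.I)⁻¹ * ∮ ζ in C(0, 1), f ζ * d.eval ζ := by
    induction m with
    | zero => exact ⟨0, fun z => ⟨0, by simp, by simp [circleIntegral]⟩⟩
    | succ m ih =>
      obtain ⟨P, hP⟩ := ih
      refine ⟨C ((2 * (Real.pi : ℂ) * Complex.I)⁻¹ * ∮ ζ in C(0, 1), f ζ * (C a * X ^ m : ℂ[X]).eval ζ)
        + X * P, fun z => ?_⟩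
      obtain ⟨d, hd, hPd⟩ := hP z
      -- The divided difference obeys ζ^(m+1) - z^(m+1) = (ζ - z) ζ^m + z (ζ^m - z^m), so its
      -- integral picks up one moment and a factor z.
      refine ⟨C a * X ^ m + C z * d, ?_, ?_⟩
      · rw [mul_add, mul_left_comm (X - C z) (C z), ← hd]
        simp only [eval_mul, eval_C, eval_pow, eval_X, C_mul, C_pow]
        ring
      · simp only [eval_add, eval_C, eval_mul, eval_X, eval_pow, hPd, mul_add]
        have h1 := hint (C a * X ^ m)
        have h2 := hint (C z * d)
        simp only [eval_C, eval_mul, eval_X, eval_pow] at h1 h2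
        rw [circleIntegral.integral_add h1 h2]
        simp_rw [mul_left_comm (f _) z]
        rw [circleIntegral.integral_const_mul]
        ring
  induction q using Polynomial.induction_on' with
  | add p q hp hq =>
    obtain ⟨P, hP⟩ := hp
    obtain ⟨Q, hQ⟩ := hq
    refine ⟨P + Q, fun z => ?_⟩
    obtain ⟨d, hd, hPd⟩ := hP z
    obtain ⟨e, he, hQe⟩ := hQ z
    refine ⟨d + e, ?_, ?_⟩
    · rw [mul_add, ← hd, ← he]
      simp only [eval_add, C_add]
      ring
    · simp only [eval_add, mul_add, hPd, hQe]
      rw [circleIntegral.integral_add (hint d) (hint e), mul_add]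
  | monomial m a =>
    rw [← C_mul_X_pow_eq_monomial]
    exact hmonom m a

end BiorthUnitCircle

/-! ### Behaviour of the weight at the zeros of W, and integration by parts. -/

namespace BiorthUnitCircle

open MeasureTheory Filter Topology Set

lemma intervalIntegrable_comp_circleMap {f : ℂ → ℂ} (hf : CircleIntegrable f 0 1) (a b : ℝ) :
    IntervalIntegrable (fun θ => f (circleMap 0 1 θ)) volume a b :=
  ((periodic_circleMap 0 1).comp f).intervalIntegrable₀ Real.two_pi_pos.ne' hf a b

/-- A function with integrable derivative next to `0` has a limit at `0`, and the limit vanishes if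
the quotient by a function of size at most `t` is integrable as well. -/
lemma tendsto_zero_of_integrable_div {u u' s : ℝ → ℂ} {δ : ℝ} (hδ : 0 < δ)
    (hu : ∀ t ∈ Ioo 0 δ, HasDerivAt u (u' t) t) (hu' : IntervalIntegrable u' volume 0 δ)
    (hs : ∀ t ∈ Ioo 0 δ, s t ≠ 0 ∧ ‖s t‖ ≤ t)
    (hus : IntervalIntegrable (fun t => u t / s t) volume 0 δ) :
    Tendsto u (𝓝[>] 0) (𝓝 0) := by
  have hmem : Ioo 0 (δ / 2) ∈ 𝓝[>] (0 : ℝ) := Ioo_mem_nhdsGT (by positivity)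
  have hsubset : uIcc 0 (δ / 2) ⊆ uIcc 0 δ := by
    rw [uIcc_of_le (by positivity), uIcc_of_le hδ.le]
    exact Icc_subset_Icc_right (by linarith)
  have hu'' : IntervalIntegrable u' volume 0 (δ / 2) := hu'.mono_set hsubset
  have hprim := intervalIntegral.continuousOn_primitive_interval' hu''
    (right_mem_uIcc : δ / 2 ∈ uIcc 0 (δ / 2)) 0 left_mem_uIcc
  have hlim : Tendsto u (𝓝[>] 0) (𝓝 (u (δ / 2) + ∫ x in (δ / 2)..0, u' x)) := by
    have h1 : Tendsto (fun b => ∫ x in (δ / 2)..b, u' x) (𝓝[>] 0)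
        (𝓝 (∫ x in (δ / 2)..0, u' x)) := by
      refine Tendsto.mono_left hprim (nhdsWithin_le_of_mem ?_)
      filter_upwards [hmem] with t ht
      rw [uIcc_of_le (by positivity)]
      exact ⟨ht.1.le, ht.2.le⟩
    refine (h1.const_add (u (δ / 2))).congr' ?_
    filter_upwards [hmem] with t ht
    rw [intervalIntegral.integral_eq_sub_of_hasDerivAt (f := u)]
    · ring
    · intro x hx
      rw [uIcc_of_ge ht.2.le] at hx
      exact hu x ⟨ht.1.trans_le hx.1, by linarith [hx.2]⟩
    · refine (hu''.mono_set ?_).symm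
      rw [uIcc_of_le ht.2.le, uIcc_of_le (by positivity)]
      exact Icc_subset_Icc_left ht.1.le
  set l := u (δ / 2) + ∫ x in (δ / 2)..0, u' x with hl
  -- If the limit l were nonzero, 1/t ≤ 1/‖s‖ would be O(‖u/s‖), and integrability of u/s would
  -- contradict the divergence of log at 0.
  by_cases h0 : l = 0
  · rwa [h0] at hlim
  exfalso
  have hmem2 : Ioc 0 δ ∈ 𝓝[>] (0 : ℝ) := Ioc_mem_nhdsGT hδ
  refine not_integrableOn_of_tendsto_norm_atTop_of_deriv_isBigO_filter (f := Real.log) (𝓝[>] (0 : ℝ))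
    hmem2 ?_ (tendsto_abs_atBot_atTop.comp Real.tendsto_log_nhdsGT_zero) ?_ hus.1
  · filter_upwards [self_mem_nhdsWithin] with t ht
    exact Real.differentiableAt_log (ne_of_gt ht)
  · have h1 : (fun t => (s t)⁻¹ * u t * (u t)⁻¹) =O[𝓝[>] 0] fun t => (s t)⁻¹ * u t * 1 :=
      (Asymptotics.isBigO_refl _ _).mul ((hlim.inv₀ h0).isBigO_one ℂ)
    have h2 : deriv Real.log =O[𝓝[>] 0] fun t => (s t)⁻¹ * u t * (u t)⁻¹ := by
      refine Asymptotics.IsBigO.of_bound 1 ?_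
      filter_upwards [hmem, hlim.eventually_ne h0] with t ht hut
      obtain ⟨h3, h4⟩ := hs t ⟨ht.1, by linarith [ht.2]⟩
      rw [Real.deriv_log, mul_inv_cancel_right₀ hut, one_mul, norm_inv, norm_inv,
        Real.norm_of_nonneg ht.1.le]
      gcongr
    refine (h2.trans h1).congr_right fun t => ?_
    rw [mul_one, div_eq_inv_mul]

namespace IsRegularSemiclassical

variable {w : ℂ → ℂ} {V W : ℂ[X]}

lemma ne_zero (hw : IsRegularSemiclassical w V W) : W ≠ 0 := by
  intro h
  have := hw.two_le_degree
  simp [h] at this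

lemma finite_zeros (hw : IsRegularSemiclassical w V W) : {z : ℂ | W.eval z = 0}.Finite := by
  refine (W.roots.toFinset.finite_toSet).subset fun z hz => ?_
  simpa [hw.ne_zero] using hz

lemma eval_V_ne_zero (hw : IsRegularSemiclassical w V W) {z : ℂ} (hz : W.eval z = 0) :
    V.eval z ≠ 0 := by
  intro h
  exact hw.residue_ne z hz 0 (by simp [h])

/-- The weight has an integrable Cauchy kernel at each zero of `W`. -/
lemma circleIntegrable_div_sub_of_zero (hw : IsRegularSemiclassical w V W)
    (hint : CircleIntegrable w 0 1) (hint' : CircleIntegrable (weightDeriv w) 0 1) {z : ℂ}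
    (hz : W.eval z = 0) : CircleIntegrable (fun ζ => w ζ / (ζ - z)) 0 1 := by
  obtain ⟨U, hU⟩ := dvd_iff_isRoot.2 hz
  obtain ⟨V₁, hV₁⟩ := X_sub_C_dvd_sub_C_eval (p := V) (a := z)
  have hVz := hw.eval_V_ne_zero hz
  have h1 := circleIntegrable_mul_continuousOn hint' (U.continuous.continuousOn)
  have h2 := circleIntegrable_mul_continuousOn hint (V₁.continuous.continuousOn)
  -- With W = (ζ - z)U and V = V(z) + (ζ - z)V₁, the equation W w' = 2 V w divided by ζ - z reads
  -- w/(ζ - z) = (U w'/2 - V₁ w)/V(z).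
  have h3 := ((h1.const_smul (a := (1 / 2 : ℂ))).sub h2).const_smul (a := (V.eval z)⁻¹)
  refine circleIntegrable_congr_off_finite hw.finite_zeros (fun ζ hζ hWζ => ?_) h3
  have hp := hw.pearson ζ hζ hWζ
  have hV : V.eval ζ = V.eval z + (ζ - z) * V₁.eval ζ := by
    have := congrArg (eval ζ) hV₁
    simp only [eval_sub, eval_C, eval_mul, eval_X] at this
    linear_combination this
  have hWU : W.eval ζ = (ζ - z) * U.eval ζ := by simp [hU]
  have hne : ζ - z ≠ 0 := by
    intro h
    exact hWζ (by simp [hWU, h])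
  simp only [Pi.smul_apply, Pi.sub_apply, smul_eq_mul]
  rw [hV, hWU] at hp
  field_simp
  linear_combination hp

lemma circleIntegrable_div_sub (hw : IsRegularSemiclassical w V W)
    (hint : CircleIntegrable w 0 1) (hint' : CircleIntegrable (weightDeriv w) 0 1) {z : ℂ}
    (hz : z ∉ unitCircle ∨ W.eval z = 0) : CircleIntegrable (fun ζ => w ζ / (ζ - z)) 0 1 :=
  hz.elim (BiorthUnitCircle.circleIntegrable_div_sub hint)
    (hw.circleIntegrable_div_sub_of_zero hint hint')

lemma hasDerivAt_comp_circleMap (hw : IsRegularSemiclassical w V W) {θ : ℝ}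
    (hθ : W.eval (circleMap 0 1 θ) ≠ 0) :
    HasDerivAt (fun θ => w (circleMap 0 1 θ))
      (circleMap 0 1 θ * Complex.I * weightDeriv w (circleMap 0 1 θ)) θ := by
  have h1 := (hw.differentiable _ (circleMap_mem_unitCircle θ) hθ).hasDerivWithinAt
  exact h1.scomp_hasDerivAt θ (hasDerivAt_circleMap 0 1 θ) circleMap_mem_unitCircle

lemma eventually_eval_circleMap_ne_zero (hw : IsRegularSemiclassical w V W) (θ : ℝ) :
    ∀ᶠ t in 𝓝[≠] θ, W.eval (circleMap 0 1 t) ≠ 0 := by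
  have h1 : ∀ᶠ t in 𝓝[≠] θ, circleMap 0 1 t ≠ circleMap 0 1 θ :=
    (hasDerivAt_circleMap 0 1 θ).eventually_ne (by simp)
  have h2 : ({z : ℂ | W.eval z = 0} \ {circleMap 0 1 θ})ᶜ ∈ 𝓝 (circleMap 0 1 θ) :=
    (hw.finite_zeros.subset sdiff_subset).isClosed.isOpen_compl.mem_nhds (by simp)
  have h3 := (continuous_circleMap 0 1).continuousAt.eventually h2
  filter_upwards [h1, h3.filter_mono nhdsWithin_le_nhds] with t ht1 ht2 ht3
  exact ht2 ⟨ht3, ht1⟩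

lemma norm_circleMap_sub_le (a b : ℝ) : ‖circleMap 0 1 a - circleMap 0 1 b‖ ≤ |a - b| := by
  have := (lipschitzWith_circleMap 0 1).dist_le_mul a b
  simpa [dist_eq_norm] using this

/-- The values σ = ±1 give the two sides of the zero, along which w may follow different branches.
The quotient of w by the chord is integrable, and the chord is at most the arc t, so
`tendsto_zero_of_integrable_div` applies. -/
lemma tendsto_comp_circleMap (hw : IsRegularSemiclassical w V W)
    (hint : CircleIntegrable w 0 1) (hint' : CircleIntegrable (weightDeriv w) 0 1) {θ : ℝ}
    (hθ : W.eval (circleMap 0 1 θ) = 0) {σ : ℝ} (hσ : σ = 1 ∨ σ = -1) :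
    Tendsto (fun t : ℝ => w (circleMap 0 1 (θ + σ * t))) (𝓝[>] 0) (𝓝 0) := by
  have hσ0 : σ ≠ 0 := by rcases hσ with h | h <;> simp [h]
  have hσ1 : |σ| = 1 := by rcases hσ with h | h <;> simp [h]
  have hmap : Tendsto (fun t : ℝ => θ + σ * t) (𝓝[>] 0) (𝓝[≠] θ) := by
    refine tendsto_nhdsWithin_iff.2 ⟨?_, ?_⟩
    · refine (Continuous.tendsto' (by fun_prop) _ _ (by simp)).mono_left nhdsWithin_le_nhds
    · filter_upwards [self_mem_nhdsWithin] with t ht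
      simpa [hσ0] using (ne_of_gt ht)
  obtain ⟨δ, hδ, hW⟩ := mem_nhdsGT_iff_exists_Ioo_subset.1
    (hmap.eventually (hw.eventually_eval_circleMap_ne_zero θ))
  have hii {f : ℂ → ℂ} (hf : CircleIntegrable f 0 1) :
      IntervalIntegrable (fun t : ℝ => f (circleMap 0 1 (θ + σ * t))) volume 0 δ := by
    have h := intervalIntegrable_comp_circleMap hf (θ + σ * 0) (θ + σ * δ)
    have h2 := (h.comp_add_left θ).comp_mul_left (c := σ)
    simpa [hσ0] using h2
  refine tendsto_zero_of_integrable_div (δ := δ)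
    (u' := fun t => σ * (circleMap 0 1 (θ + σ * t) * Complex.I
      * weightDeriv w (circleMap 0 1 (θ + σ * t))))
    (s := fun t => circleMap 0 1 (θ + σ * t) - circleMap 0 1 θ) hδ ?_ ?_ ?_ ?_
  · intro t ht
    have h1 := hw.hasDerivAt_comp_circleMap (hW ht)
    have h2 : HasDerivAt (fun t : ℝ => θ + σ * t) σ t := by
      simpa using ((hasDerivAt_id t).const_mul σ).const_add θ
    simpa [Function.comp_def] using! h1.scomp t h2
  · have h1 := circleIntegrable_mul_continuousOn hint' (g := fun ζ => ζ * Complex.I) (by fun_prop)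
    have h2 := (hii h1).const_mul (σ : ℂ)
    refine h2.congr fun t _ => ?_
    ring
  · intro t ht
    refine ⟨fun h => hW ht ?_, ?_⟩
    · rw [sub_eq_zero.1 h, hθ]
    · refine (norm_circleMap_sub_le _ _).trans ?_
      simp [abs_mul, hσ1, abs_of_pos ht.1]
  · exact hii (hw.circleIntegrable_div_sub_of_zero hint hint' hθ)

/-- The weight, set to `0` at the zeros of `W`, is continuous along the circle. -/
lemma continuous_ite_circleMap (hw : IsRegularSemiclassical w V W)
    (hint : CircleIntegrable w 0 1) (hint' : CircleIntegrable (weightDeriv w) 0 1) :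
    Continuous fun θ : ℝ =>
      if W.eval (circleMap 0 1 θ) = 0 then 0 else w (circleMap 0 1 θ) := by
  refine continuous_iff_continuousAt.2 fun θ => ?_
  by_cases hθ : W.eval (circleMap 0 1 θ) = 0
  · rw [continuousAt_iff_punctured_nhds]
    simp only [hθ, if_true]
    have h1 : Tendsto (fun t => w (circleMap 0 1 t)) (𝓝[≠] θ) (𝓝 0) := by
      rw [← nhdsLT_sup_nhdsGT, tendsto_sup]
      constructor
      · have h := hw.tendsto_comp_circleMap hint hint' hθ (Or.inr rfl)
        have h2 : Tendsto (fun t : ℝ => θ - t) (𝓝[<] θ) (𝓝[>] 0) := by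
          refine tendsto_nhdsWithin_iff.2 ⟨?_, ?_⟩
          · exact (Continuous.tendsto' (by fun_prop) _ _ (by simp)).mono_left nhdsWithin_le_nhds
          · filter_upwards [self_mem_nhdsWithin] with t ht
            simpa using ht
        refine (h.comp h2).congr fun t => ?_
        simp
      · have h := hw.tendsto_comp_circleMap hint hint' hθ (Or.inl rfl)
        have h2 : Tendsto (fun t : ℝ => t - θ) (𝓝[>] θ) (𝓝[>] 0) := by
          refine tendsto_nhdsWithin_iff.2 ⟨?_, ?_⟩
          · exact (Continuous.tendsto' (by fun_prop) _ _ (by simp)).mono_left nhdsWithin_le_nhds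
          · filter_upwards [self_mem_nhdsWithin] with t ht
            simpa using ht
        refine (h.comp h2).congr fun t => ?_
        simp
    refine h1.congr' ?_
    filter_upwards [hw.eventually_eval_circleMap_ne_zero θ] with t ht
    simp [ht]
  · refine (hw.hasDerivAt_comp_circleMap hθ).continuousAt.congr ?_
    have : Continuous fun t => W.eval (circleMap 0 1 t) :=
      W.continuous.comp (continuous_circleMap 0 1)
    filter_upwards [this.continuousAt.eventually_ne hθ] with t ht
    simp [ht]

/-- Integration by parts against the weight on the circle. -/
lemma circleIntegral_parts (hw : IsRegularSemiclassical w V W)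
    (hint : CircleIntegrable w 0 1) (hint' : CircleIntegrable (weightDeriv w) 0 1)
    {g g' : ℂ → ℂ} (hg : ∀ ζ ∈ unitCircle, HasDerivAt g (g' ζ) ζ)
    (hg' : ContinuousOn g' unitCircle) :
    ∮ ζ in C(0, 1), (weightDeriv w ζ * g ζ + w ζ * g' ζ) = 0 := by
  have hgc : ContinuousOn g unitCircle := fun ζ hζ =>
    (hg ζ hζ).continuousAt.continuousWithinAt
  have hi : CircleIntegrable (fun ζ => weightDeriv w ζ * g ζ + w ζ * g' ζ) 0 1 :=
    (circleIntegrable_mul_continuousOn hint' hgc).add (circleIntegrable_mul_continuousOn hint hg')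
  have hcm (θ : ℝ) : HasDerivAt (fun t => g (circleMap 0 1 t))
      (circleMap 0 1 θ * Complex.I * g' (circleMap 0 1 θ)) θ :=
    (hg _ (circleMap_mem_unitCircle θ)).scomp θ (hasDerivAt_circleMap 0 1 θ)
  -- The fundamental theorem is applied to the continuous modification of w times g; it needs
  -- differentiability only off the countable set of angles over zeros of W. The endpoint values
  -- agree by periodicity.
  have key := integral_eq_of_hasDerivAt_off_countable_of_le
    (fun θ : ℝ => (if W.eval (circleMap 0 1 θ) = 0 then 0 else w (circleMap 0 1 θ))
      * g (circleMap 0 1 θ))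
    (fun θ => deriv (circleMap 0 1) θ • (weightDeriv w (circleMap 0 1 θ) * g (circleMap 0 1 θ)
      + w (circleMap 0 1 θ) * g' (circleMap 0 1 θ)))
    Real.two_pi_pos.le
    (hw.finite_zeros.countable.preimage_circleMap 0 one_ne_zero) ?_ ?_ hi.out
  · rw [circleIntegral, key]
    have h0 : circleMap 0 1 (2 * Real.pi) = circleMap 0 1 0 := by simp [circleMap]
    simp only [h0, sub_self]
  · refine Continuous.continuousOn ((hw.continuous_ite_circleMap hint hint').mul ?_)
    exact continuous_iff_continuousAt.2 fun θ => (hcm θ).continuousAt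
  · intro θ hθ
    have hθ' : W.eval (circleMap 0 1 θ) ≠ 0 := hθ.2
    have h1 := (hw.hasDerivAt_comp_circleMap hθ').mul (hcm θ)
    refine (h1.congr_of_eventuallyEq ?_).congr_deriv ?_
    · have : Continuous fun t => W.eval (circleMap 0 1 t) :=
        W.continuous.comp (continuous_circleMap 0 1)
      filter_upwards [this.continuousAt.eventually_ne hθ'] with t ht
      simp [ht]
    · rw [deriv_circleMap, smul_eq_mul]
      ring

end IsRegularSemiclassical

end BiorthUnitCircle

/-! ### Cauchy transforms of polynomial multiples of the weight, modulo polynomials. -/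

namespace BiorthUnitCircle

open MeasureTheory Filter Topology Set

/-- The Cauchy transform of a polynomial multiple of the weight. -/
def polyTransform (w : ℂ → ℂ) (p : ℂ[X]) : ℂ → ℂ :=
  cauchyTransform fun ζ => w ζ * p.eval ζ

/-- The points at which the Cauchy integrals are considered: the complement of the circle together
with the zeros of `W`. -/
def admissible (W : ℂ[X]) : Set ℂ := {z | z ∉ unitCircle ∨ W.eval z = 0}

lemma circleIntegrable_mul_eval {w : ℂ → ℂ} (hint : CircleIntegrable w 0 1) (p : ℂ[X]) :
    CircleIntegrable (fun ζ => w ζ * p.eval ζ) 0 1 :=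
  circleIntegrable_mul_continuousOn hint p.continuous.continuousOn

namespace IsRegularSemiclassical

variable {w : ℂ → ℂ} {V W : ℂ[X]}

lemma circleIntegrable_mul_div_sub (hw : IsRegularSemiclassical w V W)
    (hint : CircleIntegrable w 0 1) (hint' : CircleIntegrable (weightDeriv w) 0 1) {z : ℂ}
    (hz : z ∈ admissible W) {g : ℂ → ℂ} (hg : ContinuousOn g unitCircle) :
    CircleIntegrable (fun ζ => w ζ * g ζ / (ζ - z)) 0 1 := by
  simp_rw [mul_div_right_comm]
  exact circleIntegrable_mul_continuousOn (hw.circleIntegrable_div_sub hint hint' hz) hg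

lemma polyTransform_X_mul (hw : IsRegularSemiclassical w V W)
    (hint : CircleIntegrable w 0 1) (hint' : CircleIntegrable (weightDeriv w) 0 1) {z : ℂ}
    (hz : z ∈ admissible W) (p : ℂ[X]) :
    polyTransform w (X * p) z
      = z * polyTransform w p z + circMean (fun ζ => w ζ * (X * p).eval ζ) := by
  have h := cauchyTransform_id_mul (circleIntegrable_mul_eval hint p)
    (hw.circleIntegrable_mul_div_sub hint hint' hz p.continuous.continuousOn)
  simp only [polyTransform, eval_mul, eval_X, mul_left_comm (w _)]
  exact h

lemma polyTransform_add (hw : IsRegularSemiclassical w V W)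
    (hint : CircleIntegrable w 0 1) (hint' : CircleIntegrable (weightDeriv w) 0 1) {z : ℂ}
    (hz : z ∈ admissible W) (p q : ℂ[X]) :
    polyTransform w (p + q) z = polyTransform w p z + polyTransform w q z := by
  simp only [polyTransform, eval_add, mul_add]
  exact cauchyTransform_add
    (hw.circleIntegrable_mul_div_sub hint hint' hz p.continuous.continuousOn)
    (hw.circleIntegrable_mul_div_sub hint hint' hz q.continuous.continuousOn)

end IsRegularSemiclassical

lemma polyTransform_C_mul (w : ℂ → ℂ) (c : ℂ) (p : ℂ[X]) (z : ℂ) :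
    polyTransform w (C c * p) z = c * polyTransform w p z := by
  simp only [polyTransform, eval_mul, eval_C, mul_left_comm (w _)]
  exact cauchyTransform_const_mul _ _ _

namespace IsRegularSemiclassical

variable {w : ℂ → ℂ} {V W : ℂ[X]}

/-- Multiplication by a polynomial commutes with the transform up to a polynomial. -/
lemma exists_eval_mul_polyTransform (hw : IsRegularSemiclassical w V W)
    (hint : CircleIntegrable w 0 1) (hint' : CircleIntegrable (weightDeriv w) 0 1) (q p : ℂ[X]) :
    ∃ P : ℂ[X], ∀ z ∈ admissible W,
      q.eval z * polyTransform w p z = polyTransform w (q * p) z + P.eval z := by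
  induction q using Polynomial.induction_on' with
  | add q r hq hr =>
    obtain ⟨P, hP⟩ := hq
    obtain ⟨Q, hQ⟩ := hr
    refine ⟨P + Q, fun z hz => ?_⟩
    rw [add_mul, hw.polyTransform_add hint hint' hz, eval_add, add_mul, hP z hz, hQ z hz, eval_add]
    ring
  | monomial m a =>
    rw [← C_mul_X_pow_eq_monomial]
    induction m with
    | zero => exact ⟨0, fun z _ => by simp [polyTransform_C_mul]⟩
    | succ m ih =>
      obtain ⟨P, hP⟩ := ih
      refine ⟨X * P - C (circMean fun ζ => w ζ * (X * (C a * X ^ m * p)).eval ζ), fun z hz => ?_⟩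
      have h1 : C a * X ^ (m + 1) * p = X * (C a * X ^ m * p) := by ring
      rw [h1, hw.polyTransform_X_mul hint hint' hz]
      have := hP z hz
      simp only [eval_mul, eval_C, eval_pow, eval_X, eval_sub] at this ⊢
      linear_combination z * this

/-- The derivative of the transform satisfies an inhomogeneous first order relation. -/
lemma exists_eval_mul_deriv_polyTransform (hw : IsRegularSemiclassical w V W)
    (hint : CircleIntegrable w 0 1) (hint' : CircleIntegrable (weightDeriv w) 0 1) (p : ℂ[X]) :
    ∃ P : ℂ[X], ∀ z ∈ admissible W,
      W.eval z * deriv (polyTransform w p) z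
        = polyTransform w (2 * V * p + W * derivative p) z + P.eval z := by
  set f : ℂ → ℂ := fun ζ => weightDeriv w ζ * p.eval ζ + w ζ * (derivative p).eval ζ with hf
  have hfi : CircleIntegrable f 0 1 :=
    (circleIntegrable_mul_eval hint' p).add (circleIntegrable_mul_eval hint (derivative p))
  obtain ⟨P, hP⟩ := exists_polynomial_integral_dividedDifference hfi W
  refine ⟨-P, fun z hz => ?_⟩
  obtain ⟨d, hd, hPd⟩ := hP z
  have hdζ (ζ : ℂ) : W.eval ζ - W.eval z = (ζ - z) * d.eval ζ := by
    have := congrArg (eval ζ) hd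
    simpa using this
  have hpearson {ζ : ℂ} (hζ : ζ ∈ unitCircle) (h0 : W.eval ζ ≠ 0) :
      w ζ * (2 * V * p + W * derivative p).eval ζ = W.eval ζ * f ζ := by
    have := hw.pearson ζ hζ h0
    simp only [hf, eval_add, eval_mul, eval_ofNat]
    linear_combination - p.eval ζ * this
  rw [eval_neg, hPd]
  -- At a zero of W on the circle the factor W(z) = 0 makes the value of `deriv` irrelevant. There
  -- W(ζ)/(ζ - z) = d(ζ), so the transform on the right cancels the polynomial term.
  by_cases hzT : z ∈ unitCircle
  · have hz0 : W.eval z = 0 := hz.resolve_left (not_not.2 hzT)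
    rw [hz0, zero_mul, polyTransform, cauchyTransform, circleIntegral_congr_off_finite
      (g := fun ζ => f ζ * d.eval ζ) (hw.finite_zeros) fun ζ hζ h0 => ?_]
    · ring
    · have hne : ζ - z ≠ 0 := fun h => h0 (by simpa [sub_eq_zero.1 h] using hz0)
      have := hdζ ζ
      rw [hpearson hζ h0]
      field_simp
      rw [hz0] at this
      linear_combination f ζ * this
  -- Off the circle, integration by parts trades the kernel (ζ - z)⁻² for (wp)'/(ζ - z). Then W(z) =
  -- W(ζ) - (ζ - z) d(ζ) moves W inside the integral, where W (wp)' = w(2Vp + Wp').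
  · have hparts : (∮ ζ in C(0, 1), w ζ * p.eval ζ / (ζ - z) ^ 2) = ∮ ζ in C(0, 1), f ζ / (ζ - z) := by
      have hne {ζ : ℂ} (hζ : ζ ∈ unitCircle) : ζ - z ≠ 0 := fun h =>
        hzT (by rwa [← sub_eq_zero.1 h])
      have h1 := hw.circleIntegral_parts hint hint' (g := fun ζ => p.eval ζ / (ζ - z))
        (g' := fun ζ => ((derivative p).eval ζ * (ζ - z) - p.eval ζ * 1) / (ζ - z) ^ 2)
        (fun ζ hζ => (p.hasDerivAt ζ).fun_div ((hasDerivAt_id ζ).sub_const z) (hne hζ))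
        (ContinuousOn.div (by fun_prop) (by fun_prop) fun ζ hζ => pow_ne_zero 2 (hne hζ))
      have h2 : CircleIntegrable (fun ζ => w ζ * p.eval ζ / (ζ - z) ^ 2) 0 1 := by
        simp_rw [div_eq_mul_inv, mul_assoc]
        refine circleIntegrable_mul_continuousOn hint (ContinuousOn.mul (by fun_prop) ?_)
        exact ContinuousOn.inv₀ (by fun_prop) fun ζ hζ => pow_ne_zero 2 (hne hζ)
      have h3 := BiorthUnitCircle.circleIntegrable_div_sub hfi hzT
      refine (sub_eq_zero.1 ?_).symm
      rw [← circleIntegral.integral_sub h3 h2]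
      refine Eq.trans ?_ h1
      refine circleIntegral.integral_congr zero_le_one fun ζ hζ => ?_
      have := hne hζ
      simp only [hf]
      field_simp
      ring
    have hder := (hasDerivAt_cauchyTransform (circleIntegrable_mul_eval hint p) hzT).deriv
    have h4 : CircleIntegrable
        (fun ζ => w ζ * (2 * V * p + W * derivative p).eval ζ / (ζ - z)) 0 1 :=
      hw.circleIntegrable_mul_div_sub hint hint' hz (Polynomial.continuous _).continuousOn
    rw [polyTransform, polyTransform, hder, hparts, cauchyTransform, ← sub_eq_add_neg, ← mul_sub,
      ← circleIntegral.integral_sub h4 (circleIntegrable_mul_eval hfi d), mul_left_comm,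
      ← circleIntegral.integral_const_mul (W.eval z)]
    congr 1
    refine circleIntegral_congr_off_finite hw.finite_zeros fun ζ hζ h0 => ?_
    have hne : ζ - z ≠ 0 := fun h => hzT (by rwa [← sub_eq_zero.1 h])
    rw [hpearson hζ h0]
    field_simp
    linear_combination - f ζ * hdζ ζ

end IsRegularSemiclassical

end BiorthUnitCircle

/-! ### Spectral derivatives from a monomial Casoratian. -/

namespace BiorthUnitCircle

open MeasureTheory Filter Topology Set

/-- Only continuity of R is needed: each step evaluates P at 0 as a limit, splits off a factor X and
cancels z on the punctured neighbourhood. -/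
lemma X_pow_dvd_of_eventually_eq {N : ℕ} {P : ℂ[X]} {R : ℂ → ℂ} (hR : ContinuousAt R 0)
    (h : ∀ᶠ z in 𝓝[≠] 0, P.eval z = z ^ N * R z) : X ^ N ∣ P := by
  induction N generalizing P with
  | zero => simp
  | succ N ih =>
    have h0 : P.eval 0 = 0 := by
      have h1 : Tendsto (fun z => P.eval z) (𝓝[≠] 0) (𝓝 (P.eval 0)) :=
        P.continuous.continuousAt.tendsto.mono_left nhdsWithin_le_nhds
      have h2 : Tendsto (fun z => z ^ (N + 1) * R z) (𝓝[≠] 0) (𝓝 (0 ^ (N + 1) * R 0)) :=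
        (((continuous_pow (N + 1)).continuousAt (x := (0 : ℂ))).mul hR).tendsto.mono_left
          nhdsWithin_le_nhds
      simpa using tendsto_nhds_unique (h1.congr' h) h2
    obtain ⟨Q, rfl⟩ := X_dvd_iff.2 (show P.coeff 0 = 0 by rwa [coeff_zero_eq_eval_zero])
    rw [pow_succ']
    refine mul_dvd_mul_left X (ih ?_)
    filter_upwards [h, self_mem_nhdsWithin] with z hz hz0
    have hz0' : z ≠ 0 := hz0
    rw [eval_mul, eval_X, pow_succ', mul_assoc] at hz
    exact mul_left_cancel₀ hz0' hz

/-- The points 2, 3, 4, … are nonzero, lie off the circle and already determine a polynomial. -/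
lemma polynomial_eq_of_eval_eq_off_circle {p q : ℂ[X]}
    (h : ∀ z, z ∉ unitCircle → z ≠ 0 → p.eval z = q.eval z) : p = q := by
  refine Polynomial.eq_of_infinite_eval_eq p q ?_
  refine Set.infinite_of_injective_forall_mem (f := fun n : ℕ => (n : ℂ) + 2)
    (fun a b hab => by simpa using hab) fun n => h _ ?_ ?_
  · have h1 : ((n : ℂ) + 2) = ((n + 2 : ℕ) : ℂ) := by push_cast; ring
    rw [mem_unitCircle, h1, Complex.norm_natCast]
    norm_cast
    omega
  · norm_cast

namespace IsRegularSemiclassical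

variable {w : ℂ → ℂ} {V W : ℂ[X]}

lemma exists_eval_mul_deriv (hw : IsRegularSemiclassical w V W)
    (hint : CircleIntegrable w 0 1) (hint' : CircleIntegrable (weightDeriv w) 0 1)
    {p : ℂ[X]} {e : ℂ → ℂ} {α β : ℂ}
    (he : ∀ z ∈ admissible W, e z = β + α * polyTransform w p z) :
    ∃ P : ℂ[X], ∀ z ∈ admissible W, W.eval z * deriv e z
      = α * polyTransform w (2 * V * p + W * derivative p) z + P.eval z := by
  obtain ⟨P, hP⟩ := hw.exists_eval_mul_deriv_polyTransform hint hint' p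
  refine ⟨C α * P, fun z hz => ?_⟩
  have h1 : W.eval z * deriv e z = α * (W.eval z * deriv (polyTransform w p) z) := by
    by_cases hzT : z ∈ unitCircle
    · have hz0 : W.eval z = 0 := hz.resolve_left (not_not.2 hzT)
      simp [hz0]
    · have h2 : e =ᶠ[𝓝 z] fun x => β + α * polyTransform w p x := by
        filter_upwards [isOpen_compl_unitCircle.mem_nhds hzT] with x hx using he x (Or.inl hx)
      have h3 := (hasDerivAt_cauchyTransform (circleIntegrable_mul_eval hint p) hzT).differentiableAt
      have h4 : deriv e z = α * deriv (polyTransform w p) z := by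
        rw [h2.deriv_eq]
        exact ((h3.hasDerivAt.const_mul α).const_add β).deriv
      rw [h4]
      ring
  rw [h1, hP z hz, eval_mul, eval_C]
  ring

/-- Spectral derivatives of a polynomial `p` and of an associated function `e = β + α C[w p]`, in
terms of a second such pair whose Casoratian with the first is a monomial. -/
theorem existsUnique_spectral (hw : IsRegularSemiclassical w V W) (hW0 : W.eval 0 = 0)
    (hint : CircleIntegrable w 0 1) (hint' : CircleIntegrable (weightDeriv w) 0 1)
    {p p₁ : ℂ[X]} {e e₁ E E₁ : ℂ → ℂ} {α β β₁ c : ℂ} {N : ℕ}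
    (he : ∀ z ∈ admissible W, e z = β + α * polyTransform w p z)
    (he₁ : ∀ z ∈ admissible W, e₁ z = β₁ + α * polyTransform w p₁ z)
    (hc : c ≠ 0)
    (hK : ∀ z ∈ admissible W, p₁.eval z * e z - p.eval z * e₁ z = c * z ^ N)
    (hE : AnalyticAt ℂ E 0) (hE₁ : AnalyticAt ℂ E₁ 0)
    (heE : ∀ z, z ∉ unitCircle → e z = z ^ N * E z)
    (heE₁ : ∀ z, z ∉ unitCircle → e₁ z = z ^ N * E₁ z) :
    (∃! q : ℂ[X] × ℂ[X], ∀ z, z ∉ unitCircle →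
      W.eval z * (derivative p).eval z
        = q.1.eval z * p₁.eval z - (q.2.eval z + V.eval z) * p.eval z ∧
      W.eval z * deriv e z = q.1.eval z * e₁ z - (q.2.eval z - V.eval z) * e z) ∧
    ∀ q : ℂ[X] × ℂ[X], (∀ z, z ∉ unitCircle →
      W.eval z * (derivative p).eval z
        = q.1.eval z * p₁.eval z - (q.2.eval z + V.eval z) * p.eval z ∧
      W.eval z * deriv e z = q.1.eval z * e₁ z - (q.2.eval z - V.eval z) * e z) →
      ∀ z, W.eval z = 0 →
        p.eval z * e z = c * z ^ N * (q.1.eval z / (2 * V.eval z)) ∧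
        p₁.eval z * e z = c * z ^ N * ((q.2.eval z + V.eval z) / (2 * V.eval z)) ∧
        p.eval z * e₁ z = c * z ^ N * ((q.2.eval z - V.eval z) / (2 * V.eval z)) := by
  obtain ⟨P, hP⟩ := hw.exists_eval_mul_deriv hint hint' he
  -- Grouped as (2Vp + Wp')e - p(We'), both terms carry the same transform αC[w(2Vp + Wp')p], and
  -- only polynomials remain. For B below, the coefficients Vp + Wp' of e₁ and Vp₁ of e add up in
  -- the same way against p₁(We').
  obtain ⟨A, hA⟩ : ∃ A : ℂ[X], ∀ z ∈ admissible W,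
      W.eval z * (derivative p).eval z * e z - p.eval z * (W.eval z * deriv e z)
        + 2 * V.eval z * p.eval z * e z = A.eval z := by
    obtain ⟨Q₁, hQ₁⟩ := hw.exists_eval_mul_polyTransform hint hint' (2 * V * p + W * derivative p) p
    obtain ⟨Q₂, hQ₂⟩ := hw.exists_eval_mul_polyTransform hint hint' p (2 * V * p + W * derivative p)
    refine ⟨C β * (2 * V * p + W * derivative p) + C α * (Q₁ - Q₂) - p * P, fun z hz => ?_⟩
    have h1 := hQ₁ z hz
    have h2 := hQ₂ z hz
    rw [mul_comm p] at h2
    rw [hP z hz, he z hz]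
    simp only [eval_add, eval_sub, eval_mul, eval_C, eval_ofNat] at h1 h2 ⊢
    linear_combination α * h1 - α * h2
  obtain ⟨B, hB⟩ : ∃ B : ℂ[X], ∀ z ∈ admissible W,
      W.eval z * (derivative p).eval z * e₁ z - p₁.eval z * (W.eval z * deriv e z)
        + V.eval z * (p.eval z * e₁ z + p₁.eval z * e z) = B.eval z := by
    obtain ⟨Q₁, hQ₁⟩ := hw.exists_eval_mul_polyTransform hint hint' (V * p + W * derivative p) p₁
    obtain ⟨Q₂, hQ₂⟩ := hw.exists_eval_mul_polyTransform hint hint' (V * p₁) p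
    obtain ⟨Q₃, hQ₃⟩ := hw.exists_eval_mul_polyTransform hint hint' p₁ (2 * V * p + W * derivative p)
    refine ⟨C β₁ * (V * p + W * derivative p) + C β * (V * p₁) + C α * (Q₁ + Q₂ - Q₃) - p₁ * P,
      fun z hz => ?_⟩
    have h1 := hQ₁ z hz
    have h2 := hQ₂ z hz
    have h3 := hQ₃ z hz
    have h4 := hw.polyTransform_add hint hint' hz ((V * p + W * derivative p) * p₁) (V * p₁ * p)
    have h5 : (V * p + W * derivative p) * p₁ + V * p₁ * p = p₁ * (2 * V * p + W * derivative p) := by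
      ring
    rw [h5] at h4
    rw [hP z hz, he z hz, he₁ z hz]
    simp only [eval_add, eval_sub, eval_mul, eval_C] at h1 h2 h3 h4 ⊢
    linear_combination α * h1 + α * h2 - α * h3 - α * h4
  -- Cramer's rule: eliminating Ω, respectively Θ, from the two relations leaves the determinant K =
  -- c z^N. This gives uniqueness, and it transfers the values of A and B to any solution.
  have hsol : ∀ q : ℂ[X] × ℂ[X], (∀ z, z ∉ unitCircle →
      W.eval z * (derivative p).eval z
        = q.1.eval z * p₁.eval z - (q.2.eval z + V.eval z) * p.eval z ∧
      W.eval z * deriv e z = q.1.eval z * e₁ z - (q.2.eval z - V.eval z) * e z) →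
      C c * X ^ N * q.1 = A ∧ C c * X ^ N * q.2 = B := by
    intro q hq
    constructor
    · refine polynomial_eq_of_eval_eq_off_circle fun z hz _ => ?_
      obtain ⟨h1, h2⟩ := hq z hz
      rw [← hA z (Or.inl hz)]
      simp only [eval_mul, eval_C, eval_pow, eval_X]
      rw [← hK z (Or.inl hz)]
      linear_combination - e z * h1 + p.eval z * h2
    · refine polynomial_eq_of_eval_eq_off_circle fun z hz _ => ?_
      obtain ⟨h1, h2⟩ := hq z hz
      rw [← hB z (Or.inl hz)]
      simp only [eval_mul, eval_C, eval_pow, eval_X]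
      rw [← hK z (Or.inl hz)]
      linear_combination - e₁ z * h1 + p₁.eval z * h2
  have hCX : (C c * X ^ N : ℂ[X]) ≠ 0 := mul_ne_zero (C_ne_zero.2 hc) (pow_ne_zero _ X_ne_zero)
  have hmem : ∀ᶠ z in 𝓝 (0 : ℂ), z ∉ unitCircle :=
    isOpen_compl_unitCircle.mem_nhds zero_notMem_unitCircle
  have heA : AnalyticAt ℂ e 0 :=
    ((analyticAt_id.pow N).mul hE).congr (by filter_upwards [hmem] with z hz using (heE z hz).symm)
  have he₁A : AnalyticAt ℂ e₁ 0 :=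
    ((analyticAt_id.pow N).mul hE₁).congr (by filter_upwards [hmem] with z hz using (heE₁ z hz).symm)
  obtain ⟨U, hU⟩ := X_dvd_iff.2 (show W.coeff 0 = 0 by rwa [coeff_zero_eq_eval_zero])
  -- Since W = zU, the product We' still has the factor z^N.
  have hderiv : ∀ᶠ z in 𝓝 (0 : ℂ), W.eval z * deriv e z
      = z ^ N * (U.eval z * (N * E z + z * deriv E z)) := by
    filter_upwards [hE.eventually_analyticAt, (hmem.eventually_nhds)] with z hz hzT
    have h1 : e =ᶠ[𝓝 z] fun x => x ^ N * E x := by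
      filter_upwards [hzT] with x hx using heE x hx
    rw [h1.deriv_eq, ((hasDerivAt_pow N z).fun_mul hz.differentiableAt.hasDerivAt).deriv, hU]
    cases N with
    | zero => simp; ring
    | succ N =>
      simp only [eval_mul, eval_X, Nat.add_sub_cancel]
      ring
  have hdE : ContinuousAt (deriv E) 0 := hE.deriv.continuousAt
  have hEc := hE.continuousAt
  have hE₁c := hE₁.continuousAt
  have hcont (r : ℂ[X]) : ContinuousAt (fun z => r.eval z) 0 := r.continuous.continuousAt
  have hAdvd : X ^ N ∣ A := by
    refine X_pow_dvd_of_eventually_eq (R := fun z => W.eval z * (derivative p).eval z * E z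
      - p.eval z * (U.eval z * (N * E z + z * deriv E z)) + 2 * V.eval z * p.eval z * E z)
      (by fun_prop) ?_
    filter_upwards [hderiv.filter_mono nhdsWithin_le_nhds, hmem.filter_mono nhdsWithin_le_nhds]
      with z h1 h2
    rw [← hA z (Or.inl h2), h1, heE z h2]
    ring
  have hBdvd : X ^ N ∣ B := by
    refine X_pow_dvd_of_eventually_eq (R := fun z => W.eval z * (derivative p).eval z * E₁ z
      - p₁.eval z * (U.eval z * (N * E z + z * deriv E z))
      + V.eval z * (p.eval z * E₁ z + p₁.eval z * E z)) (by fun_prop) ?_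
    filter_upwards [hderiv.filter_mono nhdsWithin_le_nhds, hmem.filter_mono nhdsWithin_le_nhds]
      with z h1 h2
    rw [← hB z (Or.inl h2), h1, heE z h2, heE₁ z h2]
    ring
  obtain ⟨Θ, hΘ⟩ : ∃ Θ : ℂ[X], C c * X ^ N * Θ = A := by
    obtain ⟨D, rfl⟩ := hAdvd
    refine ⟨C c⁻¹ * D, ?_⟩
    rw [mul_mul_mul_comm, ← C_mul, mul_inv_cancel₀ hc, C_1, one_mul]
  obtain ⟨Ω, hΩ⟩ : ∃ Ω : ℂ[X], C c * X ^ N * Ω = B := by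
    obtain ⟨D, rfl⟩ := hBdvd
    refine ⟨C c⁻¹ * D, ?_⟩
    rw [mul_mul_mul_comm, ← C_mul, mul_inv_cancel₀ hc, C_1, one_mul]
  have hAz (z : ℂ) : A.eval z = c * z ^ N * Θ.eval z := by simp [← hΘ]
  have hBz (z : ℂ) : B.eval z = c * z ^ N * Ω.eval z := by simp [← hΩ]
  refine ⟨⟨(Θ, Ω), ?_, ?_⟩, ?_⟩
  · have hne {z : ℂ} (hz : z ∉ unitCircle) (hz0 : z ≠ 0) :
        p₁.eval z * e z - p.eval z * e₁ z ≠ 0 := by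
      rw [hK z (Or.inl hz)]
      exact mul_ne_zero hc (pow_ne_zero _ hz0)
    have hpoly : W * derivative p = Θ * p₁ - (Ω + V) * p := by
      refine polynomial_eq_of_eval_eq_off_circle fun z hz hz0 => ?_
      have h1 := hA z (Or.inl hz)
      have h2 := hB z (Or.inl hz)
      rw [hAz, ← hK z (Or.inl hz)] at h1
      rw [hBz, ← hK z (Or.inl hz)] at h2
      refine mul_left_cancel₀ (hne hz hz0) ?_
      simp only [eval_mul, eval_sub, eval_add]
      linear_combination p₁.eval z * h1 - p.eval z * h2
    have hfun {z : ℂ} (hz : z ∉ unitCircle) (hz0 : z ≠ 0) :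
        W.eval z * deriv e z = Θ.eval z * e₁ z - (Ω.eval z - V.eval z) * e z := by
      have h1 := hA z (Or.inl hz)
      have h2 := hB z (Or.inl hz)
      rw [hAz, ← hK z (Or.inl hz)] at h1
      rw [hBz, ← hK z (Or.inl hz)] at h2
      refine mul_left_cancel₀ (hne hz hz0) ?_
      linear_combination e₁ z * h1 - e z * h2
    intro z hz
    refine ⟨by simpa using congrArg (eval z) hpoly, ?_⟩
    -- The determinant may vanish at the origin, so there the relation for e is recovered by
    -- continuity.
    rcases eq_or_ne z 0 with rfl | hz0
    · have hec := heA.continuousAt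
      have he₁c := he₁A.continuousAt
      have hdec := heA.deriv.continuousAt
      have hl : ContinuousAt (fun z => W.eval z * deriv e z) 0 := by fun_prop
      have hr : ContinuousAt
          (fun z => Θ.eval z * e₁ z - (Ω.eval z - V.eval z) * e z) 0 := by fun_prop
      have hr' : Tendsto (fun z => Θ.eval z * e₁ z - (Ω.eval z - V.eval z) * e z) (𝓝[≠] 0) _ :=
        hr.tendsto.mono_left nhdsWithin_le_nhds
      refine tendsto_nhds_unique (hl.tendsto.mono_left nhdsWithin_le_nhds) (hr'.congr' ?_)
      filter_upwards [hmem.filter_mono nhdsWithin_le_nhds, self_mem_nhdsWithin] with z h1 h2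
      exact (hfun h1 h2).symm
    · exact hfun hz hz0
  · intro q hq
    obtain ⟨h1, h2⟩ := hsol q hq
    exact Prod.ext (mul_left_cancel₀ hCX (h1.trans hΘ.symm)) (mul_left_cancel₀ hCX (h2.trans hΩ.symm))
  · intro q hq z hz
    obtain ⟨h1, h2⟩ := hsol q hq
    have hV := hw.eval_V_ne_zero hz
    -- The formulas for A, B and K hold at zeros of W even on the circle. With W(z) = 0 they
    -- determine pe, and p₁e and pe₁ through their sum and difference.
    have h3 := hA z (Or.inr hz)
    have h4 := hB z (Or.inr hz)
    have h5 := hK z (Or.inr hz)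
    rw [← h1] at h3
    rw [← h2] at h4
    simp only [hz, eval_mul, eval_C, eval_pow, eval_X] at h3 h4
    refine ⟨?_, ?_, ?_⟩ <;> field_simp
    · linear_combination h3
    · linear_combination h4 + V.eval z * h5
    · linear_combination h4 - V.eval z * h5

end IsRegularSemiclassical

end BiorthUnitCircle

/-! ### Bi-orthonormal polynomials for a Toeplitz form: Szegő recurrences. -/

namespace BiorthUnitCircle

/-- `p`, `q` are bi-orthonormal polynomials with equal leading coefficients for the bilinear form
`B`, for which multiplication by `X` is an isometry. -/
structure IsBiorthonormal (B : ℂ[X] →ₗ[ℂ] ℂ[X] →ₗ[ℂ] ℂ) (p q : ℕ → ℂ[X]) : Prop where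
  toeplitz : ∀ a b, B (X * a) (X * b) = B a b
  degree_left : ∀ n, (p n).degree = (n : WithBot ℕ)
  degree_right : ∀ n, (q n).degree = (n : WithBot ℕ)
  coeff_eq : ∀ n, (q n).coeff n = (p n).coeff n
  orthonormal : ∀ m n, B (p m) (q n) = if m = n then 1 else 0

namespace IsBiorthonormal

variable {B : ℂ[X] →ₗ[ℂ] ℂ[X] →ₗ[ℂ] ℂ} {p q : ℕ → ℂ[X]}

lemma flip (h : IsBiorthonormal B p q) : IsBiorthonormal B.flip q p where
  toeplitz a b := h.toeplitz b a
  degree_left := h.degree_right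
  degree_right := h.degree_left
  coeff_eq n := (h.coeff_eq n).symm
  orthonormal m n := by
    rw [LinearMap.flip_apply, h.orthonormal]
    simp only [eq_comm]

lemma toeplitz_pow (h : IsBiorthonormal B p q) (j : ℕ) (a b : ℂ[X]) :
    B (X ^ j * a) (X ^ j * b) = B a b := by
  induction j with
  | zero => simp
  | succ j ih => rw [pow_succ', mul_assoc, mul_assoc, h.toeplitz, ih]

lemma coeff_left_ne_zero (h : IsBiorthonormal B p q) (n : ℕ) : (p n).coeff n ≠ 0 :=
  coeff_ne_zero_of_eq_degree (h.degree_left n)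

lemma natDegree_left (h : IsBiorthonormal B p q) (n : ℕ) : (p n).natDegree = n :=
  natDegree_eq_of_degree_eq_some (h.degree_left n)

lemma natDegree_right (h : IsBiorthonormal B p q) (n : ℕ) : (q n).natDegree = n :=
  natDegree_eq_of_degree_eq_some (h.degree_right n)

lemma coeff_left_of_lt (h : IsBiorthonormal B p q) {n m : ℕ} (hm : n < m) : (p n).coeff m = 0 :=
  coeff_eq_zero_of_natDegree_lt (by rwa [h.natDegree_left])

lemma degree_sub_lt (h : IsBiorthonormal B p q) {a : ℂ[X]} {m : ℕ} (ha : a.degree < (m + 1 : ℕ)) :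
    (a - (a.coeff m / (p m).coeff m) • q m).degree < m := by
  rw [degree_lt_iff_coeff_zero] at ha ⊢
  intro k hk
  rcases hk.eq_or_lt with rfl | hk
  · rw [coeff_sub, coeff_smul, smul_eq_mul, h.coeff_eq, div_mul_cancel₀ _ (h.coeff_left_ne_zero _),
      sub_self]
  · rw [coeff_sub, coeff_smul, ha k hk, h.flip.coeff_left_of_lt hk]
    simp

lemma left_apply_eq_zero (h : IsBiorthonormal B p q) {n : ℕ} {a : ℂ[X]} (ha : a.degree < n) :
    B (p n) a = 0 := by
  have key : ∀ m ≤ n, ∀ a : ℂ[X], a.degree < m → B (p n) a = 0 := by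
    intro m
    induction m with
    | zero =>
      intro _ a ha
      have : a = 0 := by
        rw [← degree_eq_bot]
        simpa using ha
      simp [this]
    | succ m ih =>
      intro hm a ha
      have h1 := ih (by omega) _ (h.degree_sub_lt ha)
      rwa [map_sub, map_smul, h.orthonormal, if_neg (by omega), smul_zero, sub_zero] at h1
  exact key n le_rfl a ha

lemma left_apply (h : IsBiorthonormal B p q) {n : ℕ} {a : ℂ[X]} (ha : a.natDegree ≤ n) :
    B (p n) a = a.coeff n / (p n).coeff n := by
  have h1 := h.left_apply_eq_zero (h.degree_sub_lt (a := a) (m := n)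
    ((degree_le_of_natDegree_le ha).trans_lt (by exact_mod_cast Nat.lt_succ_self n)))
  rwa [map_sub, map_smul, h.orthonormal, if_pos rfl, smul_eq_mul, mul_one, sub_eq_zero] at h1

lemma right_apply_eq_zero (h : IsBiorthonormal B p q) {n : ℕ} {a : ℂ[X]} (ha : a.degree < n) :
    B a (q n) = 0 :=
  h.flip.left_apply_eq_zero ha

lemma right_apply (h : IsBiorthonormal B p q) {n : ℕ} {a : ℂ[X]} (ha : a.natDegree ≤ n) :
    B a (q n) = a.coeff n / (p n).coeff n := by
  rw [← h.coeff_eq]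
  exact h.flip.left_apply ha

/-- Nondegeneracy: with d the degree of a, pairing a with q_d detects its leading coefficient, while
expanding q_d in monomials gives 0. -/
lemma eq_zero_of_forall_apply (h : IsBiorthonormal B p q) {n : ℕ} {a : ℂ[X]} (ha : a.degree < n)
    (h0 : ∀ j < n, B a (X ^ j) = 0) : a = 0 := by
  by_contra hne
  have hd : a.natDegree < n := (natDegree_lt_iff_degree_lt hne).2 ha
  have h1 := h.right_apply (a := a) le_rfl
  rw [(q a.natDegree).as_sum_range_C_mul_X_pow, map_sum, Finset.sum_eq_zero] at h1
  · have := h.coeff_left_ne_zero a.natDegree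
    rw [eq_comm, div_eq_zero_iff, or_iff_left this] at h1
    exact hne (leadingCoeff_eq_zero.1 h1)
  · intro j hj
    rw [h.natDegree_right, Finset.mem_range] at hj
    rw [← smul_eq_C_mul, map_smul, h0 j (by omega), smul_zero]

/-- Because multiplication by X is an isometry, X^(n-j) against b equals X^n against X^j b. This is
the algebraic form of ζ̄ = 1/ζ. -/
lemma reflect_apply (h : IsBiorthonormal B p q) {n : ℕ} (a b : ℂ[X]) (ha : a.natDegree ≤ n) :
    B (reflect n a) b = B (X ^ n) (a * b) := by
  refine induction_with_natDegree_le (fun a => B (reflect n a) b = B (X ^ n) (a * b)) n ?_ ?_ ?_ a ha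
  · simp
  · intro j r _ hj
    rw [reflect_C_mul_X_pow, revAt_le hj, mul_assoc, ← smul_eq_C_mul, ← smul_eq_C_mul, map_smul,
      map_smul, LinearMap.smul_apply, ← h.toeplitz_pow j (X ^ (n - j)), ← pow_add,
      Nat.add_sub_cancel' hj]
  · intro f g _ _ hf hg
    rw [reflect_add, map_add, LinearMap.add_apply, hf, hg, add_mul, map_add]

lemma reflect_right_apply_X_pow (h : IsBiorthonormal B p q) {n k : ℕ} (hk : k ≤ n) :
    B (reflect n (q n)) (X ^ k) = B (X ^ (n - k)) (q n) := by
  rw [h.reflect_apply _ _ (h.natDegree_right n).le, mul_comm, ← Nat.add_sub_cancel' hk, pow_add,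
    h.toeplitz_pow, Nat.add_sub_cancel' hk]

lemma reflect_right_apply_one (h : IsBiorthonormal B p q) (n : ℕ) :
    B (reflect n (q n)) 1 = 1 / (p n).coeff n := by
  have := h.reflect_right_apply_X_pow (Nat.zero_le n)
  rw [pow_zero, Nat.sub_zero] at this
  rw [this, h.right_apply (by simp)]
  simp

/-- The Szegő recurrence for `p`. -/
lemma recurrence (h : IsBiorthonormal B p q) (n : ℕ) :
    C ((p n).coeff n) * p (n + 1)
      = C ((p (n + 1)).coeff (n + 1)) * (X * p n) + C ((p (n + 1)).eval 0) * reflect n (q n) := by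
  set r := C ((p n).coeff n) * p (n + 1) - (C ((p (n + 1)).coeff (n + 1)) * (X * p n)
    + C ((p (n + 1)).eval 0) * reflect n (q n)) with hr
  have hr0 : r.coeff 0 = 0 := by
    rw [hr, coeff_sub, coeff_add, coeff_C_mul, coeff_C_mul, coeff_C_mul, coeff_reflect,
      revAt_le (Nat.zero_le n), Nat.sub_zero, h.coeff_eq, coeff_zero_eq_eval_zero,
      mul_coeff_zero, coeff_X_zero]
    ring
  obtain ⟨s, hs⟩ := X_dvd_iff.2 hr0
  have hdeg : s.degree < n := by
    rw [degree_lt_iff_coeff_zero]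
    intro m hm
    have h1 : (reflect n (q n)).coeff (m + 1) = 0 := by
      refine coeff_eq_zero_of_natDegree_lt (natDegree_reflect_le.trans_lt ?_)
      rw [h.natDegree_right]
      simp
      omega
    rw [← coeff_X_mul, ← hs, hr, coeff_sub, coeff_add, coeff_C_mul, coeff_C_mul, coeff_C_mul,
      coeff_X_mul, h1]
    rcases hm.eq_or_lt with rfl | hm
    · ring
    · rw [h.coeff_left_of_lt hm, h.coeff_left_of_lt (Nat.succ_lt_succ hm)]
      ring
  -- Each of p_(n+1), X p_n and the reflection of q_n is orthogonal to X, …, X^n, so s is orthogonal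
  -- to 1, …, X^(n-1), which suffices in degree below n.
  have hs0 : s = 0 := by
    refine h.eq_zero_of_forall_apply hdeg fun j hj => ?_
    rw [← h.toeplitz, ← hs, ← pow_succ', hr]
    have h1 : B (p (n + 1)) (X ^ (j + 1)) = 0 := h.left_apply_eq_zero (by
      rw [degree_X_pow]
      exact_mod_cast Nat.succ_lt_succ hj)
    have h2 : B (X * p n) (X ^ (j + 1)) = 0 := by
      rw [pow_succ', h.toeplitz]
      refine h.left_apply_eq_zero ?_
      rw [degree_X_pow]
      exact_mod_cast hj
    have h3 : B (reflect n (q n)) (X ^ (j + 1)) = 0 := by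
      rw [h.reflect_right_apply_X_pow (by omega)]
      refine h.right_apply_eq_zero ?_
      rw [degree_X_pow]
      exact_mod_cast Nat.sub_lt (by omega) (by omega)
    simp only [← smul_eq_C_mul, map_sub, map_add, map_smul, LinearMap.sub_apply,
      LinearMap.add_apply, LinearMap.smul_apply, h1, h2, h3]
    simp
  rw [hs0, mul_zero] at hs
  exact sub_eq_zero.1 hs

/-- The Szegő recurrence for the reciprocal polynomials. -/
lemma recurrence_reflect (h : IsBiorthonormal B p q) (n : ℕ) :
    C ((p n).coeff n) * reflect (n + 1) (q (n + 1))
      = C ((p (n + 1)).coeff (n + 1)) * reflect n (q n) + C ((q (n + 1)).eval 0) * (X * p n) := by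
  have h1 := congrArg (reflect (n + 1)) (h.flip.recurrence n)
  have h2 : reflect (n + 1) (X * q n) = reflect n (q n) := by
    rw [add_comm n 1, reflect_mul _ _ natDegree_X_le (h.natDegree_right n).le, reflect_one_X, one_mul]
  have h3 : reflect (n + 1) (reflect n (p n)) = X * p n := by
    have h4 : (reflect n (p n)).natDegree ≤ n := by
      refine natDegree_reflect_le.trans ?_
      simp [h.natDegree_left]
    have h5 := reflect_mul _ (1 : ℂ[X]) h4 (G := 1) (by simp)
    rw [mul_one, reflect_reflect, reflect_one, pow_one, mul_comm (p n)] at h5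
    exact h5
  rwa [reflect_add, reflect_C_mul, reflect_C_mul, reflect_C_mul, h2, h3, h.coeff_eq,
    h.coeff_eq] at h1

lemma X_mul_left_apply_one (h : IsBiorthonormal B p q) (n : ℕ) :
    (p (n + 1)).coeff (n + 1) * B (X * p n) 1 = - ((p (n + 1)).eval 0 / (p n).coeff n) := by
  have h1 := congrArg (fun a => B a 1) (h.recurrence n)
  have h2 : B (p (n + 1)) 1 = 0 := h.left_apply_eq_zero (by
    rw [degree_one]
    exact_mod_cast Nat.succ_pos n)
  simp only [← smul_eq_C_mul, map_add, map_smul, LinearMap.add_apply, LinearMap.smul_apply, h2,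
    smul_eq_mul, h.reflect_right_apply_one] at h1
  linear_combination -h1

/-- Pairing the reciprocal recurrence with 1 gives a second equation for the moment of X p_n;
eliminating that moment leaves this identity. -/
lemma coeff_sq (h : IsBiorthonormal B p q) (n : ℕ) :
    (p (n + 1)).coeff (n + 1) ^ 2
      = (p n).coeff n ^ 2 + (p (n + 1)).eval 0 * (q (n + 1)).eval 0 := by
  have h1 := congrArg (fun a => B a 1) (h.recurrence_reflect n)
  simp only [← smul_eq_C_mul, map_add, map_smul, LinearMap.add_apply, LinearMap.smul_apply,
    smul_eq_mul, h.reflect_right_apply_one] at h1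
  have h2 := h.X_mul_left_apply_one n
  have h3 := h.coeff_left_ne_zero n
  have h4 := h.coeff_left_ne_zero (n + 1)
  field_simp at h1 h2
  linear_combination -(q (n + 1)).eval 0 * h2 - h1

end IsBiorthonormal

end BiorthUnitCircle

/-! ### The associated functions as Cauchy transforms, their recurrences and Casoratian. -/

namespace BiorthUnitCircle

open MeasureTheory Filter Topology Set

lemma circleIntegrable_mul_eval_conj {w : ℂ → ℂ} (hint : CircleIntegrable w 0 1) (p q : ℂ[X]) :
    CircleIntegrable (fun ζ => w ζ * p.eval ζ * q.eval ((starRingEnd ℂ) ζ)) 0 1 :=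
  circleIntegrable_mul_continuousOn (circleIntegrable_mul_eval hint p)
    (q.continuous.comp Complex.continuous_conj).continuousOn

/-- The bilinear form `(p, q) ↦ ∫ w p q(ζ̄)`. -/
def momentForm (w : ℂ → ℂ) (hint : CircleIntegrable w 0 1) : ℂ[X] →ₗ[ℂ] ℂ[X] →ₗ[ℂ] ℂ :=
  LinearMap.mk₂ ℂ (fun p q => circMean fun ζ => w ζ * p.eval ζ * q.eval ((starRingEnd ℂ) ζ))
    (fun p p' q => by
      rw [← circMean_add (circleIntegrable_mul_eval_conj hint p q)
        (circleIntegrable_mul_eval_conj hint p' q)]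
      simp only [eval_add, mul_add, add_mul])
    (fun c p q => by
      rw [smul_eq_mul, ← circMean_const_mul]
      congr 1 with ζ
      simp only [eval_smul, smul_eq_mul]
      ring)
    (fun p q q' => by
      rw [← circMean_add (circleIntegrable_mul_eval_conj hint p q)
        (circleIntegrable_mul_eval_conj hint p q')]
      simp only [eval_add, mul_add])
    (fun c p q => by
      rw [smul_eq_mul, ← circMean_const_mul]
      congr 1 with ζ
      simp only [eval_smul, smul_eq_mul]
      ring)

lemma momentForm_apply {w : ℂ → ℂ} (hint : CircleIntegrable w 0 1) (p q : ℂ[X]) :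
    momentForm w hint p q = circMean fun ζ => w ζ * p.eval ζ * q.eval ((starRingEnd ℂ) ζ) := rfl

lemma momentForm_apply_one {w : ℂ → ℂ} (hint : CircleIntegrable w 0 1) (p : ℂ[X]) :
    momentForm w hint p 1 = circMean fun ζ => w ζ * p.eval ζ := by
  simp [momentForm_apply]

lemma eval_reflect {n : ℕ} {p : ℂ[X]} (hp : p.natDegree ≤ n) {ζ : ℂ} (hζ : ζ ≠ 0) :
    (reflect n p).eval ζ = ζ ^ n * p.eval ζ⁻¹ := by
  refine induction_with_natDegree_le (fun p => (reflect n p).eval ζ = ζ ^ n * p.eval ζ⁻¹) n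
    (by simp) ?_ ?_ p hp
  · intro j r _ hj
    rw [reflect_C_mul_X_pow, revAt_le hj]
    simp only [eval_mul, eval_C, eval_pow, eval_X, inv_pow]
    rw [← Nat.sub_add_cancel hj, Nat.add_sub_cancel, pow_add]
    field_simp
  · intro f g _ _ hf hg
    rw [reflect_add, eval_add, eval_add, hf, hg, mul_add]

/-- Partial fractions: (ζ + z)/((ζ - z)ζ) = 2/(ζ - z) - 1/ζ. -/
lemma circMean_kernel_mul {f : ℂ → ℂ} {z : ℂ} (hf : CircleIntegrable f 0 1)
    (hfz : CircleIntegrable (fun ζ => f ζ / (ζ - z)) 0 1) :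
    circMean (fun ζ => (ζ + z) / (ζ - z) * f ζ) = 2 * cauchyTransform f z - circMean f := by
  have h1 : CircleIntegrable (fun ζ => (2 : ℂ) * (f ζ / (ζ - z))) 0 1 := hfz.const_smul (a := (2 : ℂ))
  have h2 : (∮ ζ in C(0, 1), (ζ + z) / (ζ - z) * f ζ / ζ)
      = ∮ ζ in C(0, 1), (2 * (f ζ / (ζ - z)) - f ζ / ζ) := by
    refine circleIntegral_congr_off_finite (finite_singleton z) fun ζ hζ h => ?_
    have h3 : ζ - z ≠ 0 := sub_ne_zero.2 h
    have h4 := ne_zero_of_mem_unitCircle hζ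
    field_simp
    ring
  rw [circMean, h2, circleIntegral.integral_sub h1 (circleIntegrable_div_id hf),
    circleIntegral.integral_const_mul, cauchyTransform, circMean]
  ring

lemma circleIntegrable_kernel_mul {f : ℂ → ℂ} {z : ℂ} (hf : CircleIntegrable f 0 1)
    (hfz : CircleIntegrable (fun ζ => f ζ / (ζ - z)) 0 1) :
    CircleIntegrable (fun ζ => (ζ + z) / (ζ - z) * f ζ / ζ) 0 1 := by
  refine circleIntegrable_congr_off_finite (finite_singleton z) (fun ζ hζ h => ?_)
    ((hfz.const_smul (a := (2 : ℂ))).sub (circleIntegrable_div_id hf))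
  have h3 : ζ - z ≠ 0 := sub_ne_zero.2 h
  have h4 := ne_zero_of_mem_unitCircle hζ
  simp only [Pi.sub_apply, Pi.smul_apply, smul_eq_mul]
  field_simp
  ring

namespace BiorthSystem

variable {w : ℂ → ℂ} {V W : ℂ[X]} (S : BiorthSystem w)

lemma isBiorthonormal (hint : CircleIntegrable w 0 1) :
    IsBiorthonormal (momentForm w hint) S.phi S.phiBar where
  toeplitz a b := by
    rw [momentForm_apply, momentForm_apply]
    refine circMean_congr fun ζ hζ => ?_
    have := ne_zero_of_mem_unitCircle hζ
    rw [conj_eq_inv_of_mem_unitCircle hζ]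
    simp only [eval_mul, eval_X]
    field_simp
  degree_left := S.degree_phi
  degree_right := S.degree_phiBar
  coeff_eq := S.leading_eq
  orthonormal := S.orthonormal

lemma kappa_ne_zero (n : ℕ) : S.kappa n ≠ 0 :=
  coeff_ne_zero_of_eq_degree (S.degree_phi n)

lemma natDegree_phiBar (n : ℕ) : (S.phiBar n).natDegree = n :=
  natDegree_eq_of_degree_eq_some (S.degree_phiBar n)

/-- The function `ε_n` as a Cauchy transform. -/
lemma eps_eq (hw : IsRegularSemiclassical w V W) (hint : CircleIntegrable w 0 1)
    (hint' : CircleIntegrable (weightDeriv w) 0 1) (n : ℕ) {z : ℂ} (hz : z ∈ admissible W) :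
    S.eps n z = 2 * polyTransform w (S.phi n) z := by
  have hS := S.isBiorthonormal hint
  have hF : carath w z = 2 * polyTransform w 1 z - momentForm w hint 1 1 := by
    rw [carath, circMean_kernel_mul hint (hw.circleIntegrable_div_sub hint hint' hz),
      momentForm_apply_one, polyTransform]
    simp
  have hφ : (S.phi n) = (S.phi n - C ((S.phi n).eval z)) + C ((S.phi n).eval z) * 1 := by simp
  have h1 : polyTransform w (S.phi n) z = polyTransform w (S.phi n - C ((S.phi n).eval z)) z
      + (S.phi n).eval z * polyTransform w 1 z := by
    conv_lhs => rw [hφ]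
    rw [hw.polyTransform_add hint hint' hz, polyTransform_C_mul]
  rw [eps, psi, hF]
  -- For n ≥ 1 the zeroth moment of φ_n vanishes. For n = 0 it is 1/κ_0, which the separate
  -- definition of ψ_0 compensates.
  split_ifs with hn
  · subst hn
    have h2 : S.phi 0 = C (S.kappa 0) :=
      eq_C_of_natDegree_le_zero (hS.natDegree_left 0).le
    have h3 : polyTransform w (S.phi 0) z = S.kappa 0 * polyTransform w 1 z := by
      conv_lhs => rw [h2, ← mul_one (C _), polyTransform_C_mul]
    have h4 : momentForm w hint (S.phi 0) 1 = 1 / S.kappa 0 := by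
      rw [hS.left_apply (by simp)]
      simp [kappa]
    have h5 : momentForm w hint (S.phi 0) 1 = S.kappa 0 * momentForm w hint 1 1 := by
      conv_lhs => rw [h2, ← mul_one (C _), ← smul_eq_C_mul, map_smul]
      rfl
    have h6 : (S.phi 0).eval z = S.kappa 0 := by rw [h2, eval_C]
    rw [h3, h6]
    linear_combination h5 - h4
  · have h2 : circMean (fun ζ => (ζ + z) / (ζ - z) * w ζ * ((S.phi n).eval ζ - (S.phi n).eval z))
        = 2 * polyTransform w (S.phi n - C ((S.phi n).eval z)) z
          - momentForm w hint (S.phi n - C ((S.phi n).eval z)) 1 := by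
      rw [momentForm_apply_one, polyTransform, ← circMean_kernel_mul (circleIntegrable_mul_eval hint _)
        (hw.circleIntegrable_mul_div_sub hint hint' hz (Polynomial.continuous _).continuousOn)]
      simp only [eval_sub, eval_C, mul_assoc]
    have h3 : momentForm w hint (S.phi n) 1 = 0 := hS.left_apply_eq_zero (by
      rw [degree_one]
      exact_mod_cast Nat.pos_of_ne_zero hn)
    have h4 : momentForm w hint (S.phi n - C ((S.phi n).eval z)) 1
        = - ((S.phi n).eval z * momentForm w hint 1 1) := by
      conv_lhs => rw [← mul_one (C _), ← smul_eq_C_mul, map_sub, map_smul]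
      simp [h3]
    rw [h2, h4, h1]
    ring

lemma continuousOn_eval_conj_mul_inv (p : ℂ[X]) :
    ContinuousOn (fun ζ => p.eval ((starRingEnd ℂ) ζ) * ζ⁻¹) unitCircle :=
  (p.continuous.comp Complex.continuous_conj).continuousOn.mul
    (ContinuousOn.inv₀ continuousOn_id fun _ => ne_zero_of_mem_unitCircle)

/-- On the circle φ*_n(ζ) = ζ^(n+1) (φ̄_n(ζ̄) ζ⁻¹). Of the n + 1 moments produced by the power,
orthogonality kills all but the last, which is 1/κ_n. -/
lemma polyTransform_phiStar (hw : IsRegularSemiclassical w V W) (hint : CircleIntegrable w 0 1)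
    (hint' : CircleIntegrable (weightDeriv w) 0 1) (n : ℕ) {z : ℂ} (hz : z ∈ admissible W) :
    polyTransform w (S.phiStar n) z = z ^ (n + 1) * cauchyTransform
      (fun ζ => w ζ * ((S.phiBar n).eval ((starRingEnd ℂ) ζ) * ζ⁻¹)) z + 1 / S.kappa n := by
  have hS := S.isBiorthonormal hint
  have hc := continuousOn_eval_conj_mul_inv (S.phiBar n)
  have h1 := cauchyTransform_pow_mul (circleIntegrable_mul_continuousOn hint hc)
    (hw.circleIntegrable_mul_div_sub hint hint' hz hc) (n + 1)
  have h2 : polyTransform w (S.phiStar n) z = cauchyTransform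
      (fun ζ => ζ ^ (n + 1) * (w ζ * ((S.phiBar n).eval ((starRingEnd ℂ) ζ) * ζ⁻¹))) z := by
    refine cauchyTransform_congr (fun ζ hζ => ?_) z
    have h3 := ne_zero_of_mem_unitCircle hζ
    rw [phiStar, eval_reflect (S.natDegree_phiBar n).le h3, conj_eq_inv_of_mem_unitCircle hζ]
    field_simp
    ring
  have h3 (i : ℕ) : circMean (fun ζ => ζ ^ (i + 1)
      * (w ζ * ((S.phiBar n).eval ((starRingEnd ℂ) ζ) * ζ⁻¹)))
      = momentForm w hint (X ^ i) (S.phiBar n) := by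
    rw [momentForm_apply]
    refine circMean_congr fun ζ hζ => ?_
    have := ne_zero_of_mem_unitCircle hζ
    simp only [eval_pow, eval_X]
    field_simp
    ring
  rw [h2, h1, Finset.sum_range_succ, Finset.sum_eq_zero, h3, hS.right_apply (natDegree_X_pow_le n)]
  · simp [kappa]
  · intro i hi
    rw [h3, hS.right_apply_eq_zero, mul_zero]
    rw [degree_X_pow]
    exact_mod_cast Finset.mem_range.1 hi

/-- Writing φ_n as ζ^n (φ_n ζ^(-n)) produces the moments of φ_n against degrees n - 1, …, 0, all
zero; this is the vanishing to order n at 0. -/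
lemma eps_eq_pow_mul (hw : IsRegularSemiclassical w V W) (hint : CircleIntegrable w 0 1)
    (hint' : CircleIntegrable (weightDeriv w) 0 1) (n : ℕ) {z : ℂ} (hz : z ∈ admissible W) :
    S.eps n z = z ^ n * (2 * cauchyTransform
      (fun ζ => w ζ * ((S.phi n).eval ζ * (ζ ^ n)⁻¹)) z) := by
  have hS := S.isBiorthonormal hint
  have hc : ContinuousOn (fun ζ => (S.phi n).eval ζ * (ζ ^ n)⁻¹) unitCircle :=
    (S.phi n).continuous.continuousOn.mul
      (ContinuousOn.inv₀ (by fun_prop) fun _ hζ => pow_ne_zero n (ne_zero_of_mem_unitCircle hζ))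
  have h1 := cauchyTransform_pow_mul (circleIntegrable_mul_continuousOn hint hc)
    (hw.circleIntegrable_mul_div_sub hint hint' hz hc) n
  have h2 : polyTransform w (S.phi n) z = cauchyTransform
      (fun ζ => ζ ^ n * (w ζ * ((S.phi n).eval ζ * (ζ ^ n)⁻¹))) z := by
    refine cauchyTransform_congr (fun ζ hζ => ?_) z
    have h3 := ne_zero_of_mem_unitCircle hζ
    field_simp
  have h3 : ∀ i ∈ Finset.range n, z ^ (n - 1 - i) * circMean (fun ζ => ζ ^ (i + 1)
      * (w ζ * ((S.phi n).eval ζ * (ζ ^ n)⁻¹))) = 0 := by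
    intro i hi
    have hi' : (n - 1 - i) + (i + 1) = n := by
      have := Finset.mem_range.1 hi
      omega
    have h4 : circMean (fun ζ => ζ ^ (i + 1) * (w ζ * ((S.phi n).eval ζ * (ζ ^ n)⁻¹)))
        = momentForm w hint (S.phi n) (X ^ (n - 1 - i)) := by
      rw [momentForm_apply]
      refine circMean_congr fun ζ hζ => ?_
      have := ne_zero_of_mem_unitCircle hζ
      rw [conj_eq_inv_of_mem_unitCircle hζ]
      simp only [eval_pow, eval_X, inv_pow]
      rw [show ζ ^ n = ζ ^ (n - 1 - i) * ζ ^ (i + 1) by rw [← pow_add, hi']]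
      field_simp
    rw [h4, hS.left_apply_eq_zero, mul_zero]
    rw [degree_X_pow]
    have := Finset.mem_range.1 hi
    exact_mod_cast (by omega : n - 1 - i < n)
  rw [S.eps_eq hw hint hint' n hz, h2, h1, Finset.sum_eq_zero h3]
  ring

/-- The function `ε*_n` as a Cauchy transform. -/
lemma epsStar_eq (hw : IsRegularSemiclassical w V W) (hint : CircleIntegrable w 0 1)
    (hint' : CircleIntegrable (weightDeriv w) 0 1) (n : ℕ) {z : ℂ} (hz : z ∈ admissible W) :
    S.epsStar n z = 2 / S.kappa n + -2 * polyTransform w (S.phiStar n) z := by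
  have hS := S.isBiorthonormal hint
  have hF : carath w z = 2 * polyTransform w 1 z - momentForm w hint 1 1 := by
    rw [carath, circMean_kernel_mul hint (hw.circleIntegrable_div_sub hint hint' hz),
      momentForm_apply_one, polyTransform]
    simp
  rw [epsStar, psiStar, hF]
  split_ifs with hn
  · subst hn
    have h2 : S.phiStar 0 = C (S.kappa 0) := by
      rw [phiStar, eq_C_of_natDegree_le_zero (S.natDegree_phiBar 0).le, reflect_C, pow_zero, mul_one,
        S.leading_eq]
      rfl
    have h3 : polyTransform w (S.phiStar 0) z = S.kappa 0 * polyTransform w 1 z := by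
      conv_lhs => rw [h2, ← mul_one (C _), polyTransform_C_mul]
    have h4 := hS.reflect_right_apply_one 0
    have h5 : momentForm w hint (S.phiStar 0) 1 = S.kappa 0 * momentForm w hint 1 1 := by
      conv_lhs => rw [h2, ← mul_one (C _), ← smul_eq_C_mul, map_smul]
      rfl
    have h6 : (S.phiStar 0).eval z = S.kappa 0 := by rw [h2, eval_C]
    have h7 : S.kappa 0 * momentForm w hint 1 1 = 1 / S.kappa 0 := h5.symm.trans h4
    rw [h3, h6]
    linear_combination h7
  · set g : ℂ → ℂ := fun ζ => (S.phiBar n).eval ((starRingEnd ℂ) ζ) with hg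
    have hgc : Continuous g := (S.phiBar n).continuous.comp Complex.continuous_conj
    set c := (S.phiStar n).eval z with hcdef
    have hi1 : CircleIntegrable (fun ζ => z ^ n * (w ζ * g ζ)) 0 1 :=
      (circleIntegrable_mul_continuousOn hint hgc.continuousOn).const_smul (a := z ^ n)
    have hi2 : CircleIntegrable (fun ζ => -c * w ζ) 0 1 := hint.const_smul (a := -c)
    have hi3 : CircleIntegrable (fun ζ => z ^ n * (w ζ * g ζ) / (ζ - z)) 0 1 := by
      simp_rw [mul_div_assoc]
      simp_rw [← mul_div_assoc (w _)]
      exact (hw.circleIntegrable_mul_div_sub hint hint' hz hgc.continuousOn).const_smul (a := z ^ n)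
    have hi4 : CircleIntegrable (fun ζ => -c * w ζ / (ζ - z)) 0 1 := by
      simp_rw [mul_div_assoc]
      exact (hw.circleIntegrable_div_sub hint hint' hz).const_smul (a := -c)
    have hi5 : CircleIntegrable (fun ζ => (z ^ n * (w ζ * g ζ) + -c * w ζ) / (ζ - z)) 0 1 := by
      simp_rw [add_div]
      exact hi3.add hi4
    have h2 : circMean (fun ζ => (ζ + z) / (ζ - z) * w ζ * (z ^ n * g ζ - c))
        = 2 * (z ^ n * cauchyTransform (fun ζ => w ζ * g ζ) z - c * polyTransform w 1 z)
          - (z ^ n * circMean (fun ζ => w ζ * g ζ) - c * momentForm w hint 1 1) := by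
      have h3 := circMean_kernel_mul (hi1.add hi2) hi5
      have h4 : circMean (fun ζ => (ζ + z) / (ζ - z) * w ζ * (z ^ n * g ζ - c))
          = circMean (fun ζ => (ζ + z) / (ζ - z) * (z ^ n * (w ζ * g ζ) + -c * w ζ)) := by
        congr 1 with ζ
        ring
      have h5 : cauchyTransform w z = polyTransform w 1 z := by simp [polyTransform]
      have h6 : circMean w = momentForm w hint 1 1 := by simp [momentForm_apply_one]
      rw [h4]
      refine h3.trans ?_
      rw [← h5, ← h6]
      have h7 := cauchyTransform_add hi3 hi4
      rw [cauchyTransform_const_mul, cauchyTransform_const_mul] at h7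
      have h8 := circMean_add hi1 hi2
      rw [circMean_const_mul, circMean_const_mul] at h8
      refine (congrArg₂ (fun a b => 2 * a - b) h7 h8).trans ?_
      ring
    have h3 : circMean (fun ζ => w ζ * g ζ) = 0 := by
      have h4 : momentForm w hint 1 (S.phiBar n) = 0 := hS.right_apply_eq_zero (by
        rw [degree_one]
        exact_mod_cast Nat.pos_of_ne_zero hn)
      simpa [momentForm_apply] using h4
    have h4 : cauchyTransform (fun ζ => w ζ * g ζ) z
        = z * cauchyTransform (fun ζ => w ζ * (g ζ * ζ⁻¹)) z := by
      have hc := continuousOn_eval_conj_mul_inv (S.phiBar n)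
      have h5 := cauchyTransform_id_mul (circleIntegrable_mul_continuousOn hint hc)
        (hw.circleIntegrable_mul_div_sub hint hint' hz hc)
      have h6 : ∀ ζ ∈ unitCircle, ζ * (w ζ * (g ζ * ζ⁻¹)) = w ζ * g ζ := by
        intro ζ hζ
        have := ne_zero_of_mem_unitCircle hζ
        field_simp
      rw [cauchyTransform_congr h6, circMean_congr h6, h3, add_zero] at h5
      exact h5
    rw [h2, h3, h4, S.polyTransform_phiStar hw hint hint' n hz]
    ring

lemma epsStar_eq_pow_mul (hw : IsRegularSemiclassical w V W) (hint : CircleIntegrable w 0 1)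
    (hint' : CircleIntegrable (weightDeriv w) 0 1) (n : ℕ) {z : ℂ} (hz : z ∈ admissible W) :
    S.epsStar n z = z ^ (n + 1) * (-2 * cauchyTransform
      (fun ζ => w ζ * ((S.phiBar n).eval ((starRingEnd ℂ) ζ) * ζ⁻¹)) z) := by
  rw [S.epsStar_eq hw hint hint' n hz, S.polyTransform_phiStar hw hint hint' n hz]
  ring

lemma phi_succ (hint : CircleIntegrable w 0 1) (n : ℕ) : C (S.kappa n) * S.phi (n + 1)
    = C (S.kappa (n + 1)) * (X * S.phi n) + C ((S.phi (n + 1)).eval 0) * S.phiStar n :=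
  (S.isBiorthonormal hint).recurrence n

lemma phiStar_succ (hint : CircleIntegrable w 0 1) (n : ℕ) : C (S.kappa n) * S.phiStar (n + 1)
    = C (S.kappa (n + 1)) * S.phiStar n + C ((S.phiBar (n + 1)).eval 0) * (X * S.phi n) :=
  (S.isBiorthonormal hint).recurrence_reflect n

lemma eval_phi_succ (hint : CircleIntegrable w 0 1) (n : ℕ) (z : ℂ) :
    S.kappa n * (S.phi (n + 1)).eval z = S.kappa (n + 1) * (z * (S.phi n).eval z)
      + (S.phi (n + 1)).eval 0 * (S.phiStar n).eval z := by
  simpa using congrArg (eval z) (S.phi_succ hint n)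

lemma eval_phiStar_succ (hint : CircleIntegrable w 0 1) (n : ℕ) (z : ℂ) :
    S.kappa n * (S.phiStar (n + 1)).eval z = S.kappa (n + 1) * (S.phiStar n).eval z
      + (S.phiBar (n + 1)).eval 0 * (z * (S.phi n).eval z) := by
  simpa using congrArg (eval z) (S.phiStar_succ hint n)

lemma eps_succ (hw : IsRegularSemiclassical w V W) (hint : CircleIntegrable w 0 1)
    (hint' : CircleIntegrable (weightDeriv w) 0 1) (n : ℕ) {z : ℂ} (hz : z ∈ admissible W) :
    S.kappa n * S.eps (n + 1) z
      = S.kappa (n + 1) * (z * S.eps n z) - (S.phi (n + 1)).eval 0 * S.epsStar n z := by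
  have h1 := congrArg (fun p => polyTransform w p z) (S.phi_succ hint n)
  simp only [hw.polyTransform_add hint hint' hz, polyTransform_C_mul,
    hw.polyTransform_X_mul hint hint' hz] at h1
  rw [← momentForm_apply_one hint] at h1
  have h2 := (S.isBiorthonormal hint).X_mul_left_apply_one n
  rw [S.eps_eq hw hint hint' _ hz, S.eps_eq hw hint hint' _ hz, S.epsStar_eq hw hint hint' _ hz]
  have h3 : (S.phi n).coeff n = S.kappa n := rfl
  have h4 : (S.phi (n + 1)).coeff (n + 1) = S.kappa (n + 1) := rfl
  rw [h3, h4] at h2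
  linear_combination 2 * h1 + 2 * h2

lemma epsStar_succ (hw : IsRegularSemiclassical w V W) (hint : CircleIntegrable w 0 1)
    (hint' : CircleIntegrable (weightDeriv w) 0 1) (n : ℕ) {z : ℂ} (hz : z ∈ admissible W) :
    S.kappa n * S.epsStar (n + 1) z
      = S.kappa (n + 1) * S.epsStar n z - (S.phiBar (n + 1)).eval 0 * (z * S.eps n z) := by
  have h1 := congrArg (fun p => polyTransform w p z) (S.phiStar_succ hint n)
  simp only [hw.polyTransform_add hint hint' hz, polyTransform_C_mul,
    hw.polyTransform_X_mul hint hint' hz] at h1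
  rw [← momentForm_apply_one hint] at h1
  have h2 := (S.isBiorthonormal hint).X_mul_left_apply_one n
  have h5 := (S.isBiorthonormal hint).coeff_sq n
  rw [S.epsStar_eq hw hint hint' _ hz, S.eps_eq hw hint hint' _ hz, S.epsStar_eq hw hint hint' _ hz]
  have h3 : (S.phi n).coeff n = S.kappa n := rfl
  have h4 : (S.phi (n + 1)).coeff (n + 1) = S.kappa (n + 1) := rfl
  rw [h3, h4] at h2 h5
  have h6 := S.kappa_ne_zero n
  have h7 := S.kappa_ne_zero (n + 1)
  have h8 : momentForm w hint (X * S.phi n) 1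
      = - ((S.phi (n + 1)).eval 0 / (S.kappa n * S.kappa (n + 1))) := by
    field_simp at h2 ⊢
    linear_combination h2
  rw [h8] at h1
  -- The constant terms 2/κ_n, 2/κ_(n+1) and the moment of X φ_n match exactly by `coeff_sq`.
  have h9 : S.kappa n / S.kappa (n + 1) = S.kappa (n + 1) / S.kappa n
      - (S.phiBar (n + 1)).eval 0 * ((S.phi (n + 1)).eval 0 / (S.kappa n * S.kappa (n + 1))) := by
    field_simp
    linear_combination -h5
  linear_combination -2 * h1 + 2 * h9

/-- The recurrence step multiplies this combination by z(κ_(n+1)² - φ_(n+1)(0) φ̄_(n+1)(0))/κ_n²,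
which is z by `coeff_sq`. At n = 0 the terms in F cancel. -/
lemma casoratian (hw : IsRegularSemiclassical w V W) (hint : CircleIntegrable w 0 1)
    (hint' : CircleIntegrable (weightDeriv w) 0 1) (n : ℕ) {z : ℂ} (hz : z ∈ admissible W) :
    (S.phi n).eval z * S.epsStar n z + (S.phiStar n).eval z * S.eps n z = 2 * z ^ n := by
  induction n with
  | zero =>
    have hS := S.isBiorthonormal hint
    have h1 : (S.phi 0).eval z = S.kappa 0 := by
      rw [eq_C_of_natDegree_le_zero (hS.natDegree_left 0).le, eval_C]
      rfl
    have h2 : (S.phiStar 0).eval z = S.kappa 0 := by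
      rw [phiStar, eq_C_of_natDegree_le_zero (S.natDegree_phiBar 0).le, reflect_C, pow_zero, mul_one,
        S.leading_eq, eval_C]
      rfl
    have h3 := S.kappa_ne_zero 0
    rw [eps, epsStar, psi, psiStar, if_pos rfl, if_pos rfl, h1, h2]
    field_simp
    ring
  | succ n ih =>
    have h1 := S.eval_phi_succ hint n z
    have h2 := S.eval_phiStar_succ hint n z
    have h3 := S.eps_succ hw hint hint' n hz
    have h4 := S.epsStar_succ hw hint hint' n hz
    have h5 : S.kappa (n + 1) ^ 2
        = S.kappa n ^ 2 + (S.phi (n + 1)).eval 0 * (S.phiBar (n + 1)).eval 0 :=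
      (S.isBiorthonormal hint).coeff_sq n
    refine mul_left_cancel₀ (pow_ne_zero 2 (S.kappa_ne_zero n)) ?_
    calc S.kappa n ^ 2 * ((S.phi (n + 1)).eval z * S.epsStar (n + 1) z
          + (S.phiStar (n + 1)).eval z * S.eps (n + 1) z)
        = (S.kappa n * (S.phi (n + 1)).eval z) * (S.kappa n * S.epsStar (n + 1) z)
          + (S.kappa n * (S.phiStar (n + 1)).eval z) * (S.kappa n * S.eps (n + 1) z) := by ring
      _ = z * (S.kappa (n + 1) ^ 2 - (S.phi (n + 1)).eval 0 * (S.phiBar (n + 1)).eval 0)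
          * ((S.phi n).eval z * S.epsStar n z + (S.phiStar n).eval z * S.eps n z) := by
        rw [h1, h2, h3, h4]
        ring
      _ = S.kappa n ^ 2 * (2 * z ^ (n + 1)) := by
        rw [ih, h5]
        ring

end BiorthSystem

end BiorthUnitCircle

/-! ### Spectral relations for the two systems. -/

namespace BiorthUnitCircle

namespace BiorthSystem

variable {w : ℂ → ℂ} {V W : ℂ[X]} (S : BiorthSystem w)

lemma analyticAt_cauchyTransform_mul (hint : CircleIntegrable w 0 1) (a : ℂ) {g : ℂ → ℂ}
    (hg : ContinuousOn g unitCircle) :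
    AnalyticAt ℂ (fun z => a * cauchyTransform (fun ζ => w ζ * g ζ) z) 0 :=
  analyticAt_const.mul
    (analyticAt_cauchyTransform (circleIntegrable_mul_continuousOn hint hg) zero_notMem_unitCircle)

/-- The functions `ε_n` and `ε_{n+1}` vanish to order `n` at the origin. -/
lemma exists_eps_factor (hw : IsRegularSemiclassical w V W) (hint : CircleIntegrable w 0 1)
    (hint' : CircleIntegrable (weightDeriv w) 0 1) (n : ℕ) :
    ∃ E : ℂ → ℂ, AnalyticAt ℂ E 0 ∧ ∀ z, z ∉ unitCircle → S.eps n z = z ^ n * E z := by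
  refine ⟨_, analyticAt_cauchyTransform_mul hint 2 ?_,
    fun z hz => S.eps_eq_pow_mul hw hint hint' n (Or.inl hz)⟩
  exact (S.phi n).continuous.continuousOn.mul
    (ContinuousOn.inv₀ (by fun_prop) fun _ hζ => pow_ne_zero n (ne_zero_of_mem_unitCircle hζ))

lemma exists_epsStar_factor (hw : IsRegularSemiclassical w V W) (hint : CircleIntegrable w 0 1)
    (hint' : CircleIntegrable (weightDeriv w) 0 1) (n : ℕ) :
    ∃ E : ℂ → ℂ, AnalyticAt ℂ E 0 ∧ ∀ z, z ∉ unitCircle → S.epsStar n z = z ^ (n + 1) * E z :=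
  ⟨_, analyticAt_cauchyTransform_mul hint (-2) (continuousOn_eval_conj_mul_inv (S.phiBar n)),
    fun _ hz => S.epsStar_eq_pow_mul hw hint hint' n (Or.inl hz)⟩

theorem spectral_phi (hw : IsRegularSemiclassical w V W) (hW0 : W.eval 0 = 0)
    (hint : CircleIntegrable w 0 1) (hint' : CircleIntegrable (weightDeriv w) 0 1) (n : ℕ)
    (hn : (S.phi (n + 1)).eval 0 ≠ 0) :
    (∃! p : ℂ[X] × ℂ[X], S.IsCoeffPair V W n p) ∧
    ∀ p : ℂ[X] × ℂ[X], S.IsCoeffPair V W n p → ∀ z, W.eval z = 0 →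
      (S.phi n).eval z * S.eps n z
        = 2 * ((S.phi (n + 1)).eval 0 / S.kappa n) * z ^ n * (p.1.eval z / (2 * V.eval z)) ∧
      (S.phi (n + 1)).eval z * S.eps n z
        = 2 * ((S.phi (n + 1)).eval 0 / S.kappa n) * z ^ n
          * ((p.2.eval z + V.eval z) / (2 * V.eval z)) ∧
      (S.phi n).eval z * S.eps (n + 1) z
        = 2 * ((S.phi (n + 1)).eval 0 / S.kappa n) * z ^ n
          * ((p.2.eval z - V.eval z) / (2 * V.eval z)) := by
  obtain ⟨E, hE, heE⟩ := S.exists_eps_factor hw hint hint' n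
  obtain ⟨E₁, hE₁, heE₁⟩ := S.exists_eps_factor hw hint hint' (n + 1)
  have hκ := S.kappa_ne_zero n
  -- The function ε_(n+1) vanishes to order n + 1, one more than required, whence the extra factor z
  -- in its cofactor. The constant c comes from the recurrences and the Casoratian 2z^n.
  refine hw.existsUnique_spectral hW0 hint hint' (E := E) (E₁ := fun z => z * E₁ z) (α := 2) (β := 0)
    (β₁ := 0) (c := 2 * ((S.phi (n + 1)).eval 0 / S.kappa n)) (N := n) ?_ ?_ ?_ ?_ hE
    (analyticAt_id.mul hE₁) heE ?_
  · intro z hz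
    rw [S.eps_eq hw hint hint' n hz, zero_add]
  · intro z hz
    rw [S.eps_eq hw hint hint' _ hz, zero_add]
  · exact mul_ne_zero two_ne_zero (div_ne_zero hn hκ)
  · intro z hz
    have h1 := S.eval_phi_succ hint n z
    have h2 := S.eps_succ hw hint hint' n hz
    have h3 := S.casoratian hw hint hint' n hz
    field_simp
    linear_combination S.eps n z * h1 - (S.phi n).eval z * h2 + (S.phi (n + 1)).eval 0 * h3
  · intro z hz
    rw [heE₁ z hz]
    ring

theorem spectral_phiStar (hw : IsRegularSemiclassical w V W) (hW0 : W.eval 0 = 0)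
    (hint : CircleIntegrable w 0 1) (hint' : CircleIntegrable (weightDeriv w) 0 1) (n : ℕ)
    (hn : (S.phiBar (n + 1)).eval 0 ≠ 0) :
    (∃! p : ℂ[X] × ℂ[X], S.IsCoeffPairStar V W n p) ∧
    ∀ p : ℂ[X] × ℂ[X], S.IsCoeffPairStar V W n p → ∀ z, W.eval z = 0 →
      (S.phiStar n).eval z * S.epsStar n z
        = -(2 * ((S.phiBar (n + 1)).eval 0 / S.kappa n) * z ^ (n + 1)
          * (p.1.eval z / (2 * V.eval z))) ∧
      (S.phiStar n).eval z * S.epsStar (n + 1) z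
        = -(2 * ((S.phiBar (n + 1)).eval 0 / S.kappa n) * z ^ (n + 1)
          * ((p.2.eval z + V.eval z) / (2 * V.eval z))) ∧
      (S.phiStar (n + 1)).eval z * S.epsStar n z
        = -(2 * ((S.phiBar (n + 1)).eval 0 / S.kappa n) * z ^ (n + 1)
          * ((p.2.eval z - V.eval z) / (2 * V.eval z))) := by
  obtain ⟨E, hE, heE⟩ := S.exists_epsStar_factor hw hint hint' n
  obtain ⟨E₁, hE₁, heE₁⟩ := S.exists_epsStar_factor hw hint hint' (n + 1)
  have hκ := S.kappa_ne_zero n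
  have key := hw.existsUnique_spectral hW0 hint hint' (p := S.phiStar n) (p₁ := S.phiStar (n + 1))
    (e := S.epsStar n) (e₁ := S.epsStar (n + 1)) (E := E) (E₁ := fun z => z * E₁ z) (α := -2)
    (β := 2 / S.kappa n) (β₁ := 2 / S.kappa (n + 1))
    (c := 2 * ((S.phiBar (n + 1)).eval 0 / S.kappa n)) (N := n + 1)
    (fun z hz => S.epsStar_eq hw hint hint' n hz) (fun z hz => S.epsStar_eq hw hint hint' _ hz)
    (mul_ne_zero two_ne_zero (div_ne_zero hn hκ)) ?_ hE (analyticAt_id.mul hE₁) heE ?_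
  · obtain ⟨hex, hval⟩ := key
    -- The starred relations are the general ones with Θ and Ω negated; the sign change also
    -- interchanges the roles of the second and third formulas.
    have hiff (p : ℂ[X] × ℂ[X]) : S.IsCoeffPairStar V W n p ↔ ∀ z, z ∉ unitCircle →
        W.eval z * (derivative (S.phiStar n)).eval z
          = (-p).1.eval z * (S.phiStar (n + 1)).eval z
            - ((-p).2.eval z + V.eval z) * (S.phiStar n).eval z ∧
        W.eval z * deriv (S.epsStar n) z
          = (-p).1.eval z * S.epsStar (n + 1) z - ((-p).2.eval z - V.eval z) * S.epsStar n z := by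
      refine forall₂_congr fun z _ => and_congr (Eq.congr_right ?_) (Eq.congr_right ?_) <;>
      · simp only [Prod.fst_neg, Prod.snd_neg, eval_neg]
        ring
    refine ⟨?_, fun p hp z hz => ?_⟩
    · obtain ⟨q, hq, hq'⟩ := hex
      refine ⟨-q, (hiff _).2 (by rwa [neg_neg]), fun p hp => ?_⟩
      rw [← hq' (-p) ((hiff p).1 hp), neg_neg]
    · obtain ⟨h1, h2, h3⟩ := hval (-p) ((hiff p).1 hp) z hz
      simp only [Prod.fst_neg, Prod.snd_neg, eval_neg] at h1 h2 h3
      refine ⟨?_, ?_, ?_⟩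
      · rw [h1]
        ring
      · rw [h3]
        ring
      · rw [h2]
        ring
  · intro z hz
    have h1 := S.eval_phiStar_succ hint n z
    have h2 := S.epsStar_succ hw hint hint' n hz
    have h3 := S.casoratian hw hint hint' n hz
    field_simp
    linear_combination S.epsStar n z * h1 - (S.phiStar n).eval z * h2
      + (S.phiBar (n + 1)).eval 0 * z * h3
  · intro z hz
    rw [heE₁ z hz]
    ring

lemma epsStar_zero_eq_zero (hw : IsRegularSemiclassical w V W) (hint : CircleIntegrable w 0 1)
    (hint' : CircleIntegrable (weightDeriv w) 0 1) (n : ℕ) : S.epsStar n 0 = 0 := by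
  simp [S.epsStar_eq_pow_mul hw hint hint' n (Or.inl zero_notMem_unitCircle)]

lemma eval_zero_phiStar (n : ℕ) : (S.phiStar n).eval 0 = S.kappa n := by
  rw [phiStar, ← coeff_zero_eq_eval_zero, coeff_reflect, Polynomial.revAt_le (Nat.zero_le n),
    Nat.sub_zero, S.leading_eq]
  rfl

end BiorthSystem

end BiorthUnitCircle

end

theorem mainTheorem6 (w : ℂ → ℂ) (V W : Polynomial ℂ)
    (hw : BiorthUnitCircle.IsRegularSemiclassical w V W)
    (hW0 : W.eval 0 = 0)
    (hint : CircleIntegrable w 0 1)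
    (hint' : CircleIntegrable (BiorthUnitCircle.weightDeriv w) 0 1)
    (S : BiorthUnitCircle.BiorthSystem w) (n : ℕ) :
    -- the Cauchy-type integrals converge absolutely at every finite singular point
    (∀ z : ℂ, W.eval z = 0 →
      CircleIntegrable (fun ζ => (ζ + z) / (ζ - z) * w ζ / ζ) 0 1) ∧
    -- formulae in terms of the coefficient functions of `φ_n`, `ε_n`
    ((S.phi (n + 1)).eval 0 ≠ 0 →
      (∃! p : Polynomial ℂ × Polynomial ℂ, S.IsCoeffPair V W n p) ∧
      ∀ z : ℂ, W.eval z = 0 →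
        (S.phi n).eval z * S.eps n z
            = 2 * ((S.phi (n + 1)).eval 0 / S.kappa n) * z ^ n
              * ((S.Theta V W n).eval z / (2 * V.eval z)) ∧
        (S.phi (n + 1)).eval z * S.eps n z
            = 2 * ((S.phi (n + 1)).eval 0 / S.kappa n) * z ^ n
              * (((S.Omega V W n).eval z + V.eval z) / (2 * V.eval z)) ∧
        (S.phi n).eval z * S.eps (n + 1) z
            = 2 * ((S.phi (n + 1)).eval 0 / S.kappa n) * z ^ n
              * (((S.Omega V W n).eval z - V.eval z) / (2 * V.eval z)) ∧
        (S.phi n).eval z * S.epsStar n z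
            = -(z ^ n / V.eval z) * ((S.Omega V W n).eval z - V.eval z
                - S.kappa (n + 1) / S.kappa n * z * (S.Theta V W n).eval z) ∧
        (S.phiStar n).eval z * S.eps n z
            = z ^ n / V.eval z * ((S.Omega V W n).eval z + V.eval z
                - S.kappa (n + 1) / S.kappa n * z * (S.Theta V W n).eval z)) ∧
    -- formulae in terms of the coefficient functions of `φ*_n`, `ε*_n`
    ((S.phiBar (n + 1)).eval 0 ≠ 0 →
      (∃! p : Polynomial ℂ × Polynomial ℂ, S.IsCoeffPairStar V W n p) ∧
      ∀ z : ℂ, W.eval z = 0 →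
        (S.phiStar n).eval z * S.epsStar n z
            = -(2 * ((S.phiBar (n + 1)).eval 0 / S.kappa n) * z ^ (n + 1)
              * ((S.ThetaStar V W n).eval z / (2 * V.eval z))) ∧
        (S.phiStar n).eval z * S.epsStar (n + 1) z
            = -(2 * ((S.phiBar (n + 1)).eval 0 / S.kappa n) * z ^ (n + 1)
              * (((S.OmegaStar V W n).eval z + V.eval z) / (2 * V.eval z))) ∧
        (S.phiStar (n + 1)).eval z * S.epsStar n z
            = -(2 * ((S.phiBar (n + 1)).eval 0 / S.kappa n) * z ^ (n + 1)
              * (((S.OmegaStar V W n).eval z - V.eval z) / (2 * V.eval z))) ∧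
        (S.phi n).eval z * S.epsStar n z
            = -(z ^ n / V.eval z) * ((S.OmegaStar V W n).eval z - V.eval z
                - S.kappa (n + 1) / S.kappa n * (S.ThetaStar V W n).eval z) ∧
        (S.phiStar n).eval z * S.eps n z
            = z ^ n / V.eval z * ((S.OmegaStar V W n).eval z + V.eval z
                - S.kappa (n + 1) / S.kappa n * (S.ThetaStar V W n).eval z)) := by
  have hadm {z : ℂ} (hz : W.eval z = 0) : z ∈ BiorthUnitCircle.admissible W := Or.inr hz
  have hκ := S.kappa_ne_zero n
  refine ⟨fun z hz => ?_, fun hn => ?_, fun hn => ?_⟩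
  · simpa using BiorthUnitCircle.circleIntegrable_kernel_mul hint
      (hw.circleIntegrable_div_sub hint hint' (hadm hz))
  · obtain ⟨hex, hval⟩ := S.spectral_phi hw hW0 hint hint' n hn
    have hpair : S.IsCoeffPair V W n (S.Theta V W n, S.Omega V W n) :=
      Classical.epsilon_spec hex.exists
    refine ⟨hex, fun z hz => ?_⟩
    obtain ⟨h1, h2, h3⟩ := hval _ hpair z hz
    have hV := hw.eval_V_ne_zero hz
    have hK := S.casoratian hw hint hint' n (hadm hz)
    have hr := S.eval_phi_succ hint n z
    have h5 : (S.phiStar n).eval z * S.eps n z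
        = z ^ n / V.eval z * ((S.Omega V W n).eval z + V.eval z
            - S.kappa (n + 1) / S.kappa n * z * (S.Theta V W n).eval z) := by
      field_simp at h1 h2 ⊢
      -- The recurrence for φ_(n+1), multiplied by ε_n, expresses φ_(n+1)(0) φ*_n ε_n through the
      -- two products already known.
      refine mul_left_cancel₀ hn ?_
      linear_combination (-S.kappa n * S.eps n z * V.eval z) * hr + S.kappa n * h2
        - S.kappa (n + 1) * z * h1
    refine ⟨h1, h2, h3, ?_, h5⟩
    rw [eq_sub_of_add_eq hK, h5]
    field_simp
    ring
  · obtain ⟨hex, hval⟩ := S.spectral_phiStar hw hW0 hint hint' n hn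
    have hpair : S.IsCoeffPairStar V W n (S.ThetaStar V W n, S.OmegaStar V W n) :=
      Classical.epsilon_spec hex.exists
    refine ⟨hex, fun z hz => ?_⟩
    obtain ⟨h1, h2, h3⟩ := hval _ hpair z hz
    have hV := hw.eval_V_ne_zero hz
    have hK := S.casoratian hw hint hint' n (hadm hz)
    have hr := S.eval_phiStar_succ hint n z
    have h4 : (S.phi n).eval z * S.epsStar n z
        = -(z ^ n / V.eval z) * ((S.OmegaStar V W n).eval z - V.eval z
            - S.kappa (n + 1) / S.kappa n * (S.ThetaStar V W n).eval z) := by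
      -- The recurrence for φ*_(n+1) yields φ_n ε*_n only after division by z. At z = 0 both sides
      -- vanish instead: ε*_n(0) = 0, and the bracket is the spectral relation of φ*_n at 0, where W
      -- = 0 and φ*_n, φ*_(n+1) take the values κ_n, κ_(n+1).
      rcases eq_or_ne z 0 with rfl | hz0
      · have h5 := (hpair 0 BiorthUnitCircle.zero_notMem_unitCircle).1
        simp only [hW0, zero_mul, S.eval_zero_phiStar] at h5
        have h6 : (S.OmegaStar V W n).eval 0 - V.eval 0
            - S.kappa (n + 1) / S.kappa n * (S.ThetaStar V W n).eval 0 = 0 := by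
          field_simp
          linear_combination -h5
        rw [h6, S.epsStar_zero_eq_zero hw hint hint', mul_zero, mul_zero]
      · field_simp at h1 h3 ⊢
        refine mul_left_cancel₀ (mul_ne_zero hn hz0) ?_
        linear_combination (-S.kappa n * S.epsStar n z * V.eval z) * hr + S.kappa n * h3
          - S.kappa (n + 1) * h1
    refine ⟨h1, h2, h3, h4, ?_⟩
    rw [eq_sub_of_add_eq' hK, h4]
    field_simp
    ring
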